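/- **Setting.** Let $d\in\mathbb N$, $T\in(0,\infty)$. Functions on the torus $[0,1)^d$ are identified with functions on $\mathbb R^d$ of period $1$ in each coordinate, and convolutions are over $\mathbb R^d$. For $h>0$ let $G_h(z)=(2\pi h)^{-d/2}\exp(-\frac{|z|^2}{2h})$, let $c_0=\frac1{\sqrt{2\pi}}$, let $\mathcal M$ be the set of measurable $u\colon[0,1)^d\to[0,1]$, and for $u,u'\in\mathcal M$ put $$E_h(u)=\frac1{\sqrt h}\int_{[0,1)^d}(1-u)\,G_h*u\,dx,\qquad d_h(u,u')=\Big(2\sqrt h\int_{[0,1)^d}|G_{h/2}*(u-u')|^2dx\Big)^{1/2},$$ $$|\partial E_h(u)|=\limsup_{v\in\mathcal M,\;0<d_h(v,u)\to0}\frac{(E_h(u)-E_h(v))_+}{d_h(v,u)}\in[0,\infty].$$ **Proposition 3.** Let $h\downarrow0$ be a sequence of positive numbers, $u_h\colon(0,T)\times[0,1)^d\to[0,1]$ measurable functions, and $\chi\colon(0,T)\times[0,1)^d\to\{0,1\}$ a measurable function whose spatial distributional gradient $\nabla\chi$ is a bounded measure on $(0,T)\times[0,1)^d$. Denote by $|\nabla\chi|dt$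 its total variation measure and by $\nu$ its polar vector, i.e. $\nabla\chi=\nu|\nabla\chi|dt$ and $|\nu|=1$ $|\nabla\chi|dt$-a.e. Suppose that, weakly as measures on $(z,t,x)$-space $\mathbb R^d\times(0,T)\times[0,1)^d$, as $h\downarrow0$, $$G_1(z)\tfrac1{\sqrt h}\,u_h(t,x)\,(1-u_h)(t,x-\sqrt h z)\,dx\,dt\,dz\rightharpoonup G_1(z)\,(\nu\cdot z)_+\,|\nabla\chi|\,dt\,dz,$$ $$G_1(z)\tfrac1{\sqrt h}\,(1-u_h)(t,x)\,u_h(t,x-\sqrt h z)\,dx\,dt\,dz\rightharpoonup G_1(z)\,(\nu\cdot z)_-\,|\nabla\chi|\,dt\,dz,$$ where the continuous test functions $\zeta(z,t,x)$, compactly supported in $t\in(0,T)$, may have polynomial growth in $z$. Suppose furthermore that $\liminf_{h\downarrow0}\int_0^T\frac12|\partial E_h(u_h(t))|^2dt<\infty$. Then there exists $H\in L^2(|\nabla\chi|dt)$ such that $$\int(\nabla\cdot\xi-\nu\cdot\nabla\xi\,\nu)\,|\nabla\chi|dt=-\int H\,\nu\cdot\xi\,|\nabla\chi|dt\qquad\text{for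 all }\xi\in C_0^\infty((0,T)\times[0,1)^d)^d,$$ and $$\liminf_{h\downarrow0}\int_0^T\tfrac12|\partial E_h(u_h(t))|^2dt\;\ge\;c_0\int\big(\tfrac H2\big)^2|\nabla\chi|dt,$$ all unlabelled integrals being over $(0,T)\times[0,1)^d$. -/

import Mathlib

open Set Filter Topology MeasureTheory
open scoped ENNReal ContDiff

noncomputable section

namespace Thresholding

/-- The ambient space `ℝ^d` with its Euclidean norm. -/
abbrev Space (d : ℕ) : Type := EuclideanSpace ℝ (Fin d)

/-- The fundamental domain `[0,1)^d` of the unit torus. -/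
def unitCube (d : ℕ) : Set (Space d) := {x | ∀ i, x i ∈ Ico (0 : ℝ) 1}

/-- Functions on the unit torus are functions on `ℝ^d` with period `1` in every coordinate. -/
def TorusPeriodic {d : ℕ} {α : Type*} (f : Space d → α) : Prop :=
  ∀ i : Fin d, Function.Periodic f (EuclideanSpace.single i (1 : ℝ))

/-- The heat kernel at time `h / 2`:
`G_h(z) = (2 π h)^{-d/2} exp (-|z|^2 / (2 h))`; `G_1` is the standard Gaussian. -/
def heatKernel (d : ℕ) (h : ℝ) (z : Space d) : ℝ :=
  1 / Real.sqrt (2 * Real.pi * h) ^ d * Real.exp (-(‖z‖ ^ 2) / (2 * h))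

/-- The convolution `(G_h * u)(x) = ∫ G_h(z) u(x - z) dz` over all of `ℝ^d`. -/
def heatConv {d : ℕ} (h : ℝ) (u : Space d → ℝ) (x : Space d) : ℝ :=
  ∫ z, heatKernel d h z * u (x - z)

/-- The configuration space: measurable functions on the torus with values in `[0,1]`. -/
def configSpace (d : ℕ) : Set (Space d → ℝ) :=
  {u | Measurable u ∧ TorusPeriodic u ∧ ∀ x, u x ∈ Icc (0 : ℝ) 1}

/-- `E_h(u) = h^{-1/2} ∫_{[0,1)^d} (1 - u) G_h * u dx`. -/
def energy {d : ℕ} (h : ℝ) (u : Space d → ℝ) : ℝ :=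
  1 / Real.sqrt h * ∫ x in unitCube d, (1 - u x) * heatConv h u x

/-- `d_h(u,v) = (2 h^{1/2} ∫_{[0,1)^d} |G_{h/2} * (u - v)|^2 dx)^{1/2}`. -/
def configDist {d : ℕ} (h : ℝ) (u v : Space d → ℝ) : ℝ :=
  Real.sqrt (2 * Real.sqrt h *
    ∫ x in unitCube d, (heatConv (h / 2) (fun y => u y - v y) x) ^ 2)

/-- The metric slope of `E` at `u` on the set `M` with distance `dist`:
the limit superior of `(E u - E v)_+ / dist v u` over `v` in `M` as `dist v u → 0`, with
`dist v u > 0`. -/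
def metricSlope {α : Type*} (M : Set α) (dist : α → α → ℝ) (E : α → ℝ) (u : α) : ℝ≥0∞ :=
  limsup (fun v => ENNReal.ofReal (E u - E v) / ENNReal.ofReal (dist v u))
    (comap (fun v => dist v u) (𝓝[>] (0 : ℝ)) ⊓ 𝓟 M)

/-- The metric slope `|∂E_h|` of `E_h` on the configuration space with the distance `d_h`. -/
def energySlope {d : ℕ} (h : ℝ) (u : Space d → ℝ) : ℝ≥0∞ :=
  metricSlope (configSpace d) (configDist h) (energy h) u

/-- The time-space domain `(0,T) × [0,1)^d`. -/
def timeSpace (d : ℕ) (T : ℝ) : Set (ℝ × Space d) := Ioo 0 T ×ˢ unitCube d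

/-- Smooth vector fields on `(0,T) × torus` with compact support. -/
structure IsTestField {d : ℕ} (T : ℝ) (ξ : ℝ → Space d → Space d) : Prop where
  smooth : ContDiff ℝ ∞ (fun p : ℝ × Space d => ξ p.1 p.2)
  periodic : ∀ t, TorusPeriodic (ξ t)
  support : ∃ a b : ℝ, 0 < a ∧ b < T ∧ ∀ t, t ∉ Icc a b → ∀ x, ξ t x = 0

/-- The spatial divergence of a time-dependent vector field. -/
def spaceDiv {d : ℕ} (ξ : ℝ → Space d → Space d) (p : ℝ × Space d) : ℝ :=
  ∑ i, (fderiv ℝ (ξ p.1) p.2 (EuclideanSpace.single i (1 : ℝ))) i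

/-- `ν · ∇ξ ν` at the time-space point `p`, for the spatial derivative of `ξ`. -/
def normalDeriv {d : ℕ} (ξ : ℝ → Space d → Space d) (ν : Space d) (p : ℝ × Space d) : ℝ :=
  inner ℝ ν (fderiv ℝ (ξ p.1) p.2 ν)

/-- The spatial distributional gradient `∇χ` on `(0,T) × torus` is a bounded measure with
polar factorization `∇χ = ν μ`, i.e. `μ = |∇χ|dt` and `ν` is the measure-theoretic normal.
Measures on `(0,T) × torus` are measures on `ℝ × ℝ^d` carried by `(0,T) × [0,1)^d`. -/
structure IsGradientPolar {d : ℕ} (T : ℝ) (χ : ℝ → Space d → ℝ)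
    (μ : Measure (ℝ × Space d)) (ν : ℝ × Space d → Space d) : Prop where
  bounded : IsFiniteMeasure μ
  carried : μ (timeSpace d T)ᶜ = 0
  measurable_normal : Measurable ν
  norm_normal : ∀ᵐ p ∂μ, ‖ν p‖ = 1
  gradient : ∀ ξ : ℝ → Space d → Space d, IsTestField T ξ →
    ∫ p in timeSpace d T, χ p.1 p.2 * spaceDiv ξ p = -∫ p, inner ℝ (ξ p.1 p.2) (ν p) ∂μ

/-- Continuous test functions `ζ(z,t,x)` of `z ∈ ℝ^d`, `t ∈ (0,T)` and `x` in the torus: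
compactly supported in `t`, of at most polynomial growth in `z`. -/
structure IsTestFunction {d : ℕ} (T : ℝ) (ζ : Space d → ℝ × Space d → ℝ) : Prop where
  continuous : Continuous (fun q : Space d × (ℝ × Space d) => ζ q.1 q.2)
  periodic : ∀ z t, TorusPeriodic (fun x => ζ z (t, x))
  support : ∃ a b : ℝ, 0 < a ∧ b < T ∧ ∀ z t x, t ∉ Icc a b → ζ z (t, x) = 0
  growth : ∃ (C : ℝ) (m : ℕ), ∀ z p, |ζ z p| ≤ C * (1 + ‖z‖) ^ m

/-- The weak convergence, as measures on `(z,t,x)`-space,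
`G_1(z) h^{-1/2} v_h(t,x) w_h(t, x - h^{1/2} z) dx dt dz ⇀ G_1(z) f(ν · z) |∇χ|dt dz`
along a sequence `h`, with `μ = |∇χ|dt`. -/
def CorrelationConverges {d : ℕ} (T : ℝ) (h : ℕ → ℝ) (v w : ℕ → ℝ → Space d → ℝ)
    (f : ℝ → ℝ) (μ : Measure (ℝ × Space d)) (ν : ℝ × Space d → Space d) : Prop :=
  ∀ ζ : Space d → ℝ × Space d → ℝ, IsTestFunction T ζ →
    Tendsto
      (fun k => ∫ z, ∫ p in timeSpace d T, ζ z p * (heatKernel d 1 z *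
        (1 / Real.sqrt (h k) * (v k p.1 p.2 * w k p.1 (p.2 - Real.sqrt (h k) • z)))))
      atTop
      (𝓝 (∫ z, ∫ p, ζ z p * (heatKernel d 1 z * f (inner ℝ (ν p) z)) ∂μ))

/-- `H` is the mean curvature in the weak sense:
`∫ (∇·ξ - ν·∇ξ ν) |∇χ|dt = -∫ H ν·ξ |∇χ|dt` for all compactly supported smooth `ξ`. -/
def IsMeanCurvature {d : ℕ} (T : ℝ) (μ : Measure (ℝ × Space d))
    (ν : ℝ × Space d → Space d) (H : ℝ × Space d → ℝ) : Prop :=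
  ∀ ξ : ℝ → Space d → Space d, IsTestField T ξ →
    ∫ p, (spaceDiv ξ p - normalDeriv ξ (ν p) p) ∂μ
      = -∫ p, H p * inner ℝ (ν p) (ξ p.1 p.2) ∂μ

/-- The constant `c_0 = 1 / √(2π)`. -/
def c₀ : ℝ := 1 / Real.sqrt (2 * Real.pi)

end Thresholding

end

noncomputable section

namespace Thresholding

variable {d : ℕ}

/-! ### Gaussian integrals -/

/-! Every test field ξ yields competitors for the slope: transport `u` along x ↦ x + s ξ(x). If L is
the initial rate of energy decrease and D > 0 the initial metric speed, the slope is at least L/D,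
so Young's inequality gives ½|∂E_h|² ≥ L − D²/2 (`le_metricSlope_of_curve`, `ofReal_sub_le_half_sq`,
`IsField.le_energySlope`). The difference, unlike the quotient, can be integrated in time and passed
to the limit.

For fixed h the right side is explicit. Since G_h = G_{h/2} * G_{h/2}, energy and distance depend on
u only through A = G_{h/2} * u, and the derivative W of A along the transport is again a Gaussian
operator, now with affine weight. Replacing u by 1 − u turns A into 1 − A and W into −W, so L and D²
become sums of L² pairings of an operator applied to u with one applied to 1 − u. Such a pairing is
a correlation integral of u(y)(1 − u)(y − z) against G_h(z) (`setIntegral_gaussOp_mul_gaussOp`).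
After z is rescaled by √h this is the measure of the convergence hypothesis, tested with
`correlationTest` (`IsField.variation_eq_correlation`), which differs from `limitTest` by O(√h (1 +
|z|)³). Weak convergence and the half-space moments of the Gaussian
(`integral_heatKernel_max_inner_inner`) then give, for every ξ, c₀ (δ(ξ) − ∫ (ν·ξ)² |∇χ|dt) ≤
liminf, where δ(ξ) = −∫ (∇·ξ − ν·∇ξ ν) |∇χ|dt.

Put K = liminf / c₀. Replacing ξ by xξ and optimising over real x yields δ(ξ)² ≤ 4K ‖ν·ξ‖² in
L²(|∇χ|dt). Hence δ is a bounded functional of ν·ξ; its Riesz representative is H, and ‖H‖² ≤ 4K is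
the asserted lower bound (`exists_riesz_of_abs_le`). -/

lemma heatKernel_nonneg (h : ℝ) (z : Space d) : 0 ≤ heatKernel d h z := by
  unfold heatKernel; positivity

lemma continuous_heatKernel (h : ℝ) : Continuous (heatKernel d h) := by
  unfold heatKernel; fun_prop

/-- Half of the Gaussian exponent r²/(2h) absorbs any polynomial: (1 + r)^m ≤ m! e^{1+r}, and r ≤ h
+ r²/(4h) by completing the square. -/
lemma one_add_pow_le_exp {h : ℝ} (hh : 0 < h) (m : ℕ) {r : ℝ} (hr : 0 ≤ r) :
    (1 + r) ^ m ≤ m.factorial * Real.exp (1 + h) * Real.exp (r ^ 2 / (4 * h)) := by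
  have h1 := Real.pow_div_factorial_le_exp (1 + r) (by linarith) m
  rw [div_le_iff₀ (by positivity)] at h1
  refine h1.trans ?_
  rw [mul_comm, mul_assoc, ← Real.exp_add]
  refine mul_le_mul_of_nonneg_left (Real.exp_le_exp.2 ?_) (by positivity)
  have : r ≤ h + r ^ 2 / (4 * h) := by
    have : h + r ^ 2 / (4 * h) - r = (2 * h - r) ^ 2 / (4 * h) := by field_simp; ring
    have h3 : 0 ≤ (2 * h - r) ^ 2 / (4 * h) := by positivity
    linarith
  linarith

lemma integrable_exp_neg_mul_sq_norm {b : ℝ} (hb : 0 < b) :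
    Integrable (fun z : Space d => Real.exp (-b * ‖z‖ ^ 2)) := by
  -- A non-integrable function has integral 0 by convention, whereas the known value of the Gaussian
  -- integral is positive.
  by_contra H
  have h1 := GaussianFourier.integral_rexp_neg_mul_sq_norm (V := Space d) hb
  rw [integral_undef H] at h1
  have : 0 < (Real.pi / b) ^ (Module.finrank ℝ (Space d) / 2 : ℝ) :=
    Real.rpow_pos_of_pos (by positivity) _
  linarith

lemma integrable_pow_mul_heatKernel {h : ℝ} (hh : 0 < h) (m : ℕ) :
    Integrable (fun z : Space d => (1 + ‖z‖) ^ m * heatKernel d h z) := by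
  have h1 := (integrable_exp_neg_mul_sq_norm (d := d) (b := 1 / (4 * h)) (by positivity)).const_mul
    (m.factorial * Real.exp (1 + h) * (1 / Real.sqrt (2 * Real.pi * h) ^ d))
  refine h1.mono' ?_ (ae_of_all _ fun z => ?_)
  · exact (Continuous.mul (by fun_prop) (continuous_heatKernel h)).aestronglyMeasurable
  · rw [Real.norm_of_nonneg (mul_nonneg (by positivity) (heatKernel_nonneg h z)), heatKernel]
    have h2 := one_add_pow_le_exp hh m (norm_nonneg z)
    have h3 : Real.exp (-(1 / (4 * h)) * ‖z‖ ^ 2)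
        = Real.exp (‖z‖ ^ 2 / (4 * h)) * Real.exp (-(‖z‖ ^ 2) / (2 * h)) := by
      rw [← Real.exp_add]; congr 1; field_simp; ring
    rw [h3]
    calc _ ≤ (m.factorial * Real.exp (1 + h) * Real.exp (‖z‖ ^ 2 / (4 * h))) *
          (1 / Real.sqrt (2 * Real.pi * h) ^ d * Real.exp (-(‖z‖ ^ 2) / (2 * h))) := by gcongr
      _ = _ := by ring

/-- Functions of polynomial growth are integrable against the heat kernel. -/
lemma integrable_mul_heatKernel {h : ℝ} (hh : 0 < h) {f : Space d → ℝ}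
    (hf : AEStronglyMeasurable f) (C : ℝ) (m : ℕ) (hC : ∀ z, |f z| ≤ C * (1 + ‖z‖) ^ m) :
    Integrable (fun z => heatKernel d h z * f z) := by
  refine ((integrable_pow_mul_heatKernel hh m).const_mul C).mono' ?_ (ae_of_all _ fun z => ?_)
  · exact (continuous_heatKernel h).aestronglyMeasurable.mul hf
  · rw [Real.norm_eq_abs, abs_mul, abs_of_nonneg (heatKernel_nonneg h z), ← mul_assoc, mul_comm]
    exact mul_le_mul_of_nonneg_right (hC z) (heatKernel_nonneg h z)

lemma integrable_heatKernel {h : ℝ} (hh : 0 < h) : Integrable (heatKernel d h) := by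
  simpa using integrable_pow_mul_heatKernel (d := d) hh 0

lemma integral_heatKernel {h : ℝ} (hh : 0 < h) : ∫ z, heatKernel d h z = 1 := by
  have h1 := GaussianFourier.integral_rexp_neg_mul_sq_norm (V := Space d)
    (b := 1 / (2 * h)) (by positivity)
  have h2 : ∀ z : Space d, heatKernel d h z
      = 1 / Real.sqrt (2 * Real.pi * h) ^ d * Real.exp (-(1 / (2 * h)) * ‖z‖ ^ 2) := by
    intro z; unfold heatKernel; congr 2; field_simp
  simp_rw [h2]
  rw [integral_const_mul, h1, finrank_euclideanSpace_fin,
    show Real.pi / (1 / (2 * h)) = 2 * Real.pi * h by field_simp, Real.sqrt_eq_rpow,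
    ← Real.rpow_natCast, ← Real.rpow_mul (by positivity),
    show (1 / 2 : ℝ) * d = d / 2 by ring]
  have : 0 < (2 * Real.pi * h) ^ ((d : ℝ) / 2) := Real.rpow_pos_of_pos (by positivity) _
  field_simp

lemma hasLineDerivAt_heatKernel (h : ℝ) (a z : Space d) :
    HasLineDerivAt ℝ (heatKernel d h) (-(inner ℝ a z / h) * heatKernel d h z) z a := by
  have h1 : HasFDerivAt (fun z : Space d => ‖z‖ ^ 2) (2 • innerSL ℝ z) z :=
    (hasStrictFDerivAt_norm_sq z).hasFDerivAt
  have h2 := ((h1.neg.mul_const (2 * h)⁻¹).exp.const_mul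
    (1 / Real.sqrt (2 * Real.pi * h) ^ d)).hasLineDerivAt a
  convert! h2 using 1
  simp only [heatKernel, smul_apply, neg_apply,
    innerSL_apply_apply, smul_eq_mul, Pi.neg_apply, real_inner_comm a z, nsmul_eq_mul]
  push_cast
  rw [div_eq_mul_inv _ (2 * h), mul_inv]
  ring

/-- Gaussian integration by parts. -/
lemma integral_heatKernel_inner_mul {h : ℝ} (hh : 0 < h) (a : Space d) {F F' : Space d → ℝ}
    (hF : AEStronglyMeasurable F) (hF' : AEStronglyMeasurable F')
    (hd : ∀ z, HasLineDerivAt ℝ F (F' z) z a) (C : ℝ) (m : ℕ)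
    (hC : ∀ z, |F z| ≤ C * (1 + ‖z‖) ^ m) (hC' : ∀ z, |F' z| ≤ C * (1 + ‖z‖) ^ m) :
    ∫ z, heatKernel d h z * (inner ℝ a z * F z) = h * ∫ z, heatKernel d h z * F' z := by
  have hC0 : 0 ≤ C := by simpa using (abs_nonneg _).trans (hC 0)
  have i1 : Integrable fun z => heatKernel d h z * (inner ℝ a z * F z) := by
    refine integrable_mul_heatKernel hh (by fun_prop) (‖a‖ * C) (m + 1) fun z => ?_
    rw [abs_mul, pow_succ]
    calc _ ≤ (‖a‖ * ‖z‖) * (C * (1 + ‖z‖) ^ m) :=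
          mul_le_mul (abs_real_inner_le_norm a z) (hC z) (abs_nonneg _) (by positivity)
      _ ≤ (‖a‖ * (1 + ‖z‖)) * (C * (1 + ‖z‖) ^ m) := by gcongr; linarith
      _ = _ := by ring
  have i2 := integrable_mul_heatKernel hh hF' C m hC'
  have i3 := integrable_mul_heatKernel hh hF C m hC
  have key := integral_bilinear_hasLineDerivAt_right_eq_neg_left_of_integrable
    (B := ContinuousLinearMap.mul ℝ ℝ) (f := heatKernel d h) (g := F) (g' := F') (v := a)
    (f' := fun z => -(inner ℝ a z / h) * heatKernel d h z) (μ := volume)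
    (by
      refine (i1.const_mul (-h⁻¹)).congr (ae_of_all _ fun z => ?_)
      simp only [ContinuousLinearMap.mul_apply']; ring)
    (by simpa using i2) (by simpa using i3) (fun z _ => hasLineDerivAt_heatKernel h a z)
    (fun z _ => hd z)
  simp only [ContinuousLinearMap.mul_apply'] at key
  rw [key, ← integral_neg, ← integral_const_mul]
  congr 1; ext z; field_simp

lemma hasLineDerivAt_inner (a b z : Space d) :
    HasLineDerivAt ℝ (fun z : Space d => (inner ℝ b z : ℝ)) (inner ℝ b a) z a :=
  (innerSL ℝ b).hasFDerivAt.hasLineDerivAt a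

lemma abs_inner_le_one_add (a z : Space d) : |inner ℝ a z| ≤ ‖a‖ * (1 + ‖z‖) :=
  (abs_real_inner_le_norm a z).trans (by gcongr; linarith)

lemma integral_heatKernel_inner {h : ℝ} (hh : 0 < h) (a : Space d) :
    ∫ z, heatKernel d h z * inner ℝ a z = 0 := by
  have := integral_heatKernel_inner_mul hh a (F := fun _ => 1) (F' := fun _ => 0)
    (by fun_prop) (by fun_prop) (fun z => ((hasFDerivAt_const (1 : ℝ) z).hasLineDerivAt a).congr_deriv (by simp)) 1 0 (by simp) (by simp)
  simpa using this

lemma integral_heatKernel_inner_inner {h : ℝ} (hh : 0 < h) (a b : Space d) :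
    ∫ z, heatKernel d h z * (inner ℝ a z * inner ℝ b z) = h * inner ℝ a b := by
  have := integral_heatKernel_inner_mul hh a (F := fun z => inner ℝ b z)
    (F' := fun _ => inner ℝ b a) (by fun_prop) (by fun_prop) (hasLineDerivAt_inner a b)
    (‖b‖ * (1 + ‖a‖)) 1 (fun z => (abs_inner_le_one_add b z).trans ?_)
    (fun z => (abs_real_inner_le_norm b a).trans ?_)
  · rw [this, integral_mul_const, integral_heatKernel hh, one_mul, real_inner_comm]
  · rw [pow_one]; gcongr; nlinarith [norm_nonneg a, norm_nonneg b]
  · rw [pow_one, mul_assoc]; gcongr; nlinarith [norm_nonneg a, norm_nonneg z]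

/-- The heat kernel is a product of one-dimensional Gaussians. -/
lemma heatKernel_one_eq_prod (z : Space d) :
    heatKernel d 1 z = ∏ i, (c₀ * Real.exp (-(z i) ^ 2 / 2)) := by
  rw [Finset.prod_mul_distrib, ← Real.exp_sum]
  simp only [heatKernel, c₀, EuclideanSpace.norm_sq_eq, Real.norm_eq_abs, sq_abs, mul_one,
    Finset.prod_const, Finset.card_univ, Fintype.card_fin, one_div, inv_pow, ← Finset.sum_div,
    Finset.sum_neg_distrib]

lemma integral_c₀_exp : ∫ x : ℝ, c₀ * Real.exp (-x ^ 2 / 2) = 1 := by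
  have := integral_gaussian (1 / 2)
  rw [integral_const_mul]
  have h2 : ∀ x : ℝ, -x ^ 2 / 2 = -(1 / 2) * x ^ 2 := fun x => by ring
  simp_rw [h2]
  rw [this, c₀, show Real.pi / (1 / 2) = 2 * Real.pi by ring]
  have : 0 < Real.sqrt (2 * Real.pi) := by positivity
  field_simp

/-- This half-line moment is where the factor c₀ in the limit comes from. -/
lemma integral_max_c₀_exp : ∫ x : ℝ, max x 0 * (c₀ * Real.exp (-x ^ 2 / 2)) = c₀ := by
  have h1 := integral_rpow_mul_exp_neg_mul_rpow (p := 2) (q := 1) (b := 1 / 2)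
    (by norm_num) (by norm_num) (by norm_num)
  have h3 : ∫ x : ℝ, max x 0 * (c₀ * Real.exp (-x ^ 2 / 2))
      = ∫ x in Ioi (0 : ℝ), c₀ * (x ^ (1 : ℝ) * Real.exp (-(1 / 2) * x ^ (2 : ℝ))) := by
    rw [← integral_indicator measurableSet_Ioi]
    congr 1; ext x
    by_cases hx : 0 < x
    · rw [indicator_of_mem (by exact hx), max_eq_left hx.le, Real.rpow_one, Real.rpow_two]
      rw [show -x ^ 2 / 2 = -(1 / 2) * x ^ 2 by ring]; ring
    · rw [indicator_of_notMem (by simpa using hx), max_eq_right (by linarith)]; simp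
  rw [h3, integral_const_mul, h1]
  norm_num

lemma integral_heatKernel_max_coord (i : Fin d) :
    ∫ z : Space d, heatKernel d 1 z * max (z i) 0 = c₀ := by
  have h1 := (EuclideanSpace.volume_preserving_symm_measurableEquiv_toLp (Fin d)).symm
  rw [← h1.integral_comp (MeasurableEquiv.measurableEmbedding _)]
  simp only [heatKernel_one_eq_prod]
  have h2 := integral_fintype_prod_eq_prod (𝕜 := ℝ) (ι := Fin d) (E := fun _ => ℝ)
    (μ := fun _ => (volume : Measure ℝ))
    (fun j x => (if j = i then max x 0 else 1) * (c₀ * Real.exp (-x ^ 2 / 2)))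
  have h3 : ∏ j : Fin d, ∫ x : ℝ, (if j = i then max x 0 else 1) * (c₀ * Real.exp (-x ^ 2 / 2))
      = c₀ := by
    rw [Finset.prod_eq_single i]
    · simp [integral_max_c₀_exp]
    · intro j _ hj; simp [hj, integral_c₀_exp]
    · exact fun hi => absurd (Finset.mem_univ i) hi
  refine Eq.trans ?_ (h2.trans h3)
  refine integral_congr_ae (ae_of_all _ fun x => ?_)
  simp only [Finset.prod_mul_distrib, Finset.prod_ite_eq', Finset.mem_univ, if_true]
  exact mul_comm _ _

/-- The Gaussian is invariant under the reflection that exchanges ν with a coordinate vector, which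
reduces the integral to a one-dimensional one. -/
lemma integral_heatKernel_max_inner {ν : Space d} (hν : ‖ν‖ = 1) :
    ∫ z : Space d, heatKernel d 1 z * max (inner ℝ ν z) 0 = c₀ := by
  rcases isEmpty_or_nonempty (Fin d) with hd | ⟨⟨i⟩⟩
  · have : ν = 0 := Subsingleton.elim _ _
    simp [this] at hν
  set w : Space d := EuclideanSpace.single i 1
  have hw : ‖ν‖ = ‖w‖ := by simp [w, hν]
  set R := (ℝ ∙ (ν - w))ᗮ.reflection
  have hR : R ν = w := Submodule.reflection_sub hw
  rw [← integral_heatKernel_max_coord i,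
    ← R.measurePreserving.integral_comp R.toHomeomorph.measurableEmbedding]
  congr 1; ext z
  have h1 : inner ℝ ν (R z) = z i := by
    rw [← R.inner_map_map, Submodule.reflection_reflection, hR]; simp [w, EuclideanSpace.inner_single_left]
  rw [h1]; simp [heatKernel]

/-- Although s ↦ s_+ has a kink, its square is differentiable, being O(s²) at 0. Since s_+ s = s_+²,
this permits integration by parts when one of the linear factors is ν·z. -/
lemma hasLineDerivAt_max_sq (ν a z : Space d) :
    HasLineDerivAt ℝ (fun z : Space d => (max (inner ℝ ν z) 0) ^ 2)
      (2 * max (inner ℝ ν z) 0 * inner ℝ ν a) z a := by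
  have h1 : ∀ s : ℝ, HasDerivAt (fun s : ℝ => (max s 0) ^ 2) (2 * max s 0) s := by
    intro s
    rcases lt_trichotomy s 0 with hs | rfl | hs
    · refine ((hasDerivAt_const s (0 : ℝ)).congr_of_eventuallyEq ?_).congr_deriv
        (by rw [max_eq_right hs.le]; simp)
      filter_upwards [eventually_lt_nhds hs] with x hx
      rw [max_eq_right hx.le]; simp
    · rw [hasDerivAt_iff_isLittleO]
      have : (fun x' : ℝ => max x' 0 ^ 2 - max (0 : ℝ) 0 ^ 2 - (x' - 0) • (2 * max (0 : ℝ) 0))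
          =O[𝓝 0] fun x => x ^ 2 := by
        refine Asymptotics.IsBigO.of_bound 1 (Eventually.of_forall fun x => ?_)
        simp only [max_self, sub_zero, smul_eq_mul, mul_zero, Real.norm_eq_abs, one_mul]
        rw [zero_pow two_ne_zero, sub_zero, abs_pow, abs_pow]
        refine pow_le_pow_left₀ (abs_nonneg _) ?_ 2
        rcases le_total x 0 with hx | hx <;> simp [hx]
      refine this.trans_isLittleO ?_
      simpa using Asymptotics.isLittleO_pow_id (𝕜 := ℝ) (n := 2) (by norm_num)
    · refine ((hasDerivAt_pow 2 s).congr_of_eventuallyEq ?_).congr_deriv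
        (by rw [max_eq_left hs.le]; simp)
      filter_upwards [eventually_gt_nhds hs] with x hx
      rw [max_eq_left hx.le]
  exact ((h1 _).comp_hasFDerivAt z (innerSL ℝ ν).hasFDerivAt).hasLineDerivAt a

/-- The half-space moment `∫ G_1 (ν·z)_+ (a·z) (b·z) dz`. -/
lemma integral_heatKernel_max_inner_inner {ν : Space d} (hν : ‖ν‖ = 1) (a b : Space d) :
    ∫ z : Space d, heatKernel d 1 z * (max (inner ℝ ν z) 0 * (inner ℝ a z * inner ℝ b z))
      = c₀ * (inner ℝ a b + inner ℝ ν a * inner ℝ ν b) := by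
  have hmax : ∀ z : Space d, |max (inner ℝ ν z) 0| ≤ 1 + ‖z‖ := fun z => by
    rw [abs_of_nonneg (le_max_right _ _)]
    refine max_le ((le_abs_self _).trans ((abs_inner_le_one_add ν z).trans (by rw [hν, one_mul])))
      (by positivity)
  have hone : ∀ z : Space d, (1 : ℝ) ≤ 1 + ‖z‖ := fun z => by simp
  -- If a ⊥ ν, the factor (ν·z)_+ is constant along a, so integration by parts differentiates only
  -- b·z and never sees the kink.
  have orth : ∀ a b : Space d, inner ℝ ν a = 0 →
      ∫ z : Space d, heatKernel d 1 z * (max (inner ℝ ν z) 0 * (inner ℝ a z * inner ℝ b z))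
        = c₀ * inner ℝ a b := by
    intro a b ha
    have h1 : ∀ z : Space d, HasLineDerivAt ℝ
        (fun z : Space d => max (inner ℝ ν z) 0 * inner ℝ b z)
        (max (inner ℝ ν z) 0 * inner ℝ b a) z a := by
      intro z
      have h2 : (fun t : ℝ => max (inner ℝ ν (z + t • a)) 0 * inner ℝ b (z + t • a))
          = fun t => max (inner ℝ ν z) 0 * (inner ℝ b z + t * inner ℝ b a) := by
        ext t; simp [inner_add_right, inner_smul_right, ha]
      rw [HasLineDerivAt, h2]
      simpa using ((((hasDerivAt_id (0 : ℝ)).mul_const (inner ℝ b a)).const_add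
        (inner ℝ b z)).const_mul (max (inner ℝ ν z) 0))
    have h3 := integral_heatKernel_inner_mul one_pos a (Continuous.aestronglyMeasurable (by fun_prop))
      (Continuous.aestronglyMeasurable (by fun_prop)) h1 (‖b‖ * (1 + ‖a‖)) 2
      (fun z => by
        rw [abs_mul]
        calc _ ≤ (1 + ‖z‖) * (‖b‖ * (1 + ‖z‖)) :=
              mul_le_mul (hmax z) (abs_inner_le_one_add b z) (abs_nonneg _) (by positivity)
          _ = ‖b‖ * 1 * (1 + ‖z‖) ^ 2 := by ring
          _ ≤ _ := by gcongr; exact hone a)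
      (fun z => by
        rw [abs_mul]
        calc _ ≤ (1 + ‖z‖) * (‖b‖ * (1 + ‖a‖)) :=
              mul_le_mul (hmax z) (abs_inner_le_one_add b a) (abs_nonneg _) (by positivity)
          _ = ‖b‖ * (1 + ‖a‖) * (1 + ‖z‖) ^ 1 := by ring
          _ ≤ _ := by gcongr; exacts [hone z, one_le_two])
    calc _ = ∫ z, heatKernel d 1 z * (inner ℝ a z * (max (inner ℝ ν z) 0 * inner ℝ b z)) := by
          congr 1; ext z; ring
      _ = _ := by
          rw [h3, one_mul]; simp_rw [← mul_assoc]
          rw [integral_mul_const, integral_heatKernel_max_inner hν, real_inner_comm]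
  -- For a = ν the factors combine to (ν·z)_+², and the integration by parts is done in the
  -- direction b.
  have par : ∀ b : Space d,
      ∫ z : Space d, heatKernel d 1 z * (max (inner ℝ ν z) 0 * (inner ℝ ν z * inner ℝ b z))
        = c₀ * (2 * inner ℝ ν b) := by
    intro b
    have h3 := integral_heatKernel_inner_mul one_pos b (Continuous.aestronglyMeasurable (by fun_prop))
      (Continuous.aestronglyMeasurable (by fun_prop)) (hasLineDerivAt_max_sq ν b)
      (2 * (1 + ‖b‖)) 2
      (fun z => by
        rw [abs_pow]
        calc _ ≤ (1 + ‖z‖) ^ 2 := by gcongr; exact hmax z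
          _ ≤ _ := by
            have := hone b
            exact le_mul_of_one_le_left (by positivity) (by linarith))
      (fun z => by
        rw [abs_mul, abs_mul, abs_two]
        calc _ ≤ 2 * (1 + ‖z‖) * (‖ν‖ * (1 + ‖b‖)) := by
              gcongr
              exacts [hmax z, abs_inner_le_one_add ν b]
          _ = 2 * (1 + ‖b‖) * (1 + ‖z‖) ^ 1 := by rw [hν]; ring
          _ ≤ _ := by gcongr; exacts [hone z, one_le_two])
    calc _ = ∫ z, heatKernel d 1 z * (inner ℝ b z * max (inner ℝ ν z) 0 ^ 2) := by
          congr 1; ext z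
          rcases le_total (inner ℝ ν z) 0 with hz | hz
          · simp [max_eq_right hz]
          · rw [max_eq_left hz]; ring
      _ = _ := by
          rw [h3, one_mul]
          calc _ = ∫ z, (heatKernel d 1 z * max (inner ℝ ν z) 0) * (2 * inner ℝ ν b) := by
                congr 1; ext z; ring
            _ = _ := by rw [integral_mul_const, integral_heatKernel_max_inner hν]
  -- The general case is linear: e is the part of a orthogonal to ν.
  set e := a - inner ℝ ν a • ν
  have he : inner ℝ ν e = 0 := by
    simp [e, inner_sub_right, inner_smul_right, hν]
  have hint : ∀ a b : Space d, Integrable fun z : Space d =>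
      heatKernel d 1 z * (max (inner ℝ ν z) 0 * (inner ℝ a z * inner ℝ b z)) := by
    intro a b
    refine integrable_mul_heatKernel one_pos (Continuous.aestronglyMeasurable (by fun_prop)) (‖a‖ * ‖b‖) 3 fun z => ?_
    rw [abs_mul, abs_mul]
    calc _ ≤ (1 + ‖z‖) * ((‖a‖ * (1 + ‖z‖)) * (‖b‖ * (1 + ‖z‖))) := by
          gcongr
          exacts [hmax z, abs_inner_le_one_add a z, abs_inner_le_one_add b z]
      _ = _ := by ring
  have split : ∀ z : Space d,
      heatKernel d 1 z * (max (inner ℝ ν z) 0 * (inner ℝ a z * inner ℝ b z))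
      = heatKernel d 1 z * (max (inner ℝ ν z) 0 * (inner ℝ e z * inner ℝ b z))
      + inner ℝ ν a *
        (heatKernel d 1 z * (max (inner ℝ ν z) 0 * (inner ℝ ν z * inner ℝ b z))) := by
    intro z
    have : (inner ℝ a z : ℝ) = inner ℝ e z + inner ℝ ν a * inner ℝ ν z := by
      simp [e, inner_sub_left, inner_smul_left]
    rw [this]; ring
  simp_rw [split]
  rw [integral_add (hint e b) ((hint ν b).const_mul _), integral_const_mul, orth e b he, par b]
  simp [e, inner_sub_left, inner_smul_left]
  ring

/-! ### Integrals of periodic functions -/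

lemma unitCube_eq_fundamentalDomain : unitCube d
    = ZSpan.fundamentalDomain (EuclideanSpace.basisFun (Fin d) ℝ).toBasis := by
  ext x; simp [unitCube, ZSpan.mem_fundamentalDomain]

lemma measurableSet_unitCube : MeasurableSet (unitCube d) := by
  rw [unitCube_eq_fundamentalDomain]; exact ZSpan.fundamentalDomain_measurableSet _

lemma isBounded_unitCube : Bornology.IsBounded (unitCube d) := by
  rw [unitCube_eq_fundamentalDomain]; exact ZSpan.fundamentalDomain_isBounded _

lemma volume_unitCube_lt_top : volume (unitCube d) < ⊤ := isBounded_unitCube.measure_lt_top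

instance : IsFiniteMeasure ((volume : Measure (Space d)).restrict (unitCube d)) :=
  ⟨by rw [Measure.restrict_apply_univ]; exact volume_unitCube_lt_top⟩

lemma TorusPeriodic.add_mem_span {α : Type*} {f : Space d → α} (hf : TorusPeriodic f)
    {g : Space d}
    (hg : g ∈ Submodule.span ℤ (range (EuclideanSpace.basisFun (Fin d) ℝ).toBasis)) (x : Space d) :
    f (g + x) = f x := by
  induction hg using Submodule.span_induction generalizing x with
  | mem y hy =>
    obtain ⟨i, rfl⟩ := hy
    have := hf i x
    rw [add_comm]; simpa using this
  | zero => simp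
  | add a b _ _ ha hb => rw [add_assoc, ha, hb]
  | smul n a _ ha =>
    have h1 : Function.Periodic f a := fun x => by rw [add_comm, ha]
    rw [add_comm]; exact h1.zsmul n x

/-- A translate of the cell is again a fundamental domain of the lattice, and a periodic function
has the same integral over any two of them. -/
lemma TorusPeriodic.setIntegral_add {f : Space d → ℝ} (hf : TorusPeriodic f) (w : Space d) :
    ∫ x in unitCube d, f (x + w) = ∫ x in unitCube d, f x := by
  have h1 := ZSpan.isAddFundamentalDomain' (EuclideanSpace.basisFun (Fin d) ℝ).toBasis
    (volume : Measure (Space d))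
  have : Countable (Submodule.span ℤ
      (range (EuclideanSpace.basisFun (Fin d) ℝ).toBasis)).toAddSubgroup :=
    inferInstanceAs (Countable (Submodule.span ℤ
      (range (EuclideanSpace.basisFun (Fin d) ℝ).toBasis)))
  have h2 := h1.vadd_of_comm w
  have h3 := h1.setIntegral_eq h2 (f := f) fun g x => hf.add_mem_span g.2 x
  rw [← unitCube_eq_fundamentalDomain] at h3
  have h4 := (measurePreserving_vadd w (volume : Measure (Space d))).setIntegral_image_emb
    (measurableEmbedding_const_vadd w) f (unitCube d)
  rw [h3]
  refine Eq.trans ?_ h4.symm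
  refine integral_congr_ae (ae_of_all _ fun x => ?_)
  simp [add_comm]

/-- Unfolding: in the integral of a function invariant under the diagonal action of the lattice,
the cell can be moved from one variable to the other. -/
lemma setIntegral_integral_swap {H : Space d → Space d → ℝ}
    (hm : Measurable (fun p : Space d × Space d => H p.1 p.2))
    (hp : ∀ i x y, H (x + EuclideanSpace.single i 1) (y + EuclideanSpace.single i 1) = H x y)
    {κ : Space d → ℝ} (hκ : Integrable κ) (hb : ∀ x y, |H x y| ≤ κ (x - y)) :
    ∫ x in unitCube d, ∫ y, H x y = ∫ y in unitCube d, ∫ x, H x y := by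
  have i0 : Integrable (fun p : Space d × Space d => κ p.2)
      ((volume.restrict (unitCube d)).prod volume) := by
    simpa using (integrable_const (1 : ℝ)).mul_prod hκ
  have i1 : Integrable (fun p : Space d × Space d => H p.1 (p.1 - p.2))
      ((volume.restrict (unitCube d)).prod volume) := by
    refine i0.mono' ?_ (ae_of_all _ fun p => ?_)
    · exact (hm.comp (measurable_fst.prodMk (measurable_fst.sub measurable_snd))).aestronglyMeasurable
    · simpa using hb p.1 (p.1 - p.2)
  have i2 : Integrable (fun p : Space d × Space d => H (p.1 + p.2) p.1)
      ((volume.restrict (unitCube d)).prod volume) := by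
    refine i0.mono' ?_ (ae_of_all _ fun p => ?_)
    · exact (hm.comp ((measurable_fst.add measurable_snd).prodMk measurable_fst)).aestronglyMeasurable
    · simpa using hb (p.1 + p.2) p.1
  -- The variable z = x − y turns the domain into a product. For fixed z the integrand is periodic
  -- in x, so the cell may be shifted by z, after which y is the variable confined to the cell.
  calc _ = ∫ x in unitCube d, ∫ z, H x (x - z) := by
        congr 1; ext x; exact (integral_sub_left_eq_self _ _ x).symm
    _ = ∫ z, ∫ x in unitCube d, H x (x - z) := integral_integral_swap i1
    _ = ∫ z, ∫ y in unitCube d, H (y + z) y := by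
        congr 1; ext z
        rw [← TorusPeriodic.setIntegral_add (w := z) (f := fun x => H x (x - z))]
        · simp
        · intro i x
          simp only [add_sub_right_comm, hp]
    _ = ∫ y in unitCube d, ∫ z, H (y + z) y := (integral_integral_swap i2).symm
    _ = _ := by
        congr 1; ext y; exact integral_add_left_eq_self (fun x => H x y) y

/-! ### Gaussian operators with affine weights -/

/-- The parallelogram law decouples the midpoint from the difference of the two arguments; the
normalisations agree because (h/2)² = h · h/4. -/
lemma heatKernel_mul_heatKernel {h : ℝ} (hh : 0 < h) (w z : Space d) :
    heatKernel d (h / 2) (w - (1 / 2 : ℝ) • z) * heatKernel d (h / 2) (w + (1 / 2 : ℝ) • z)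
      = heatKernel d h z * heatKernel d (h / 4) w := by
  have h1 : ‖w - (1 / 2 : ℝ) • z‖ ^ 2 + ‖w + (1 / 2 : ℝ) • z‖ ^ 2
      = 2 * ‖w‖ ^ 2 + ‖z‖ ^ 2 / 2 := by
    rw [norm_sub_sq_real, norm_add_sq_real, norm_smul, mul_pow]; norm_num; ring
  have h2 : Real.sqrt (2 * Real.pi * (h / 2)) * Real.sqrt (2 * Real.pi * (h / 2))
      = Real.sqrt (2 * Real.pi * h) * Real.sqrt (2 * Real.pi * (h / 4)) := by
    rw [← Real.sqrt_mul (by positivity), ← Real.sqrt_mul (by positivity)]; congr 1; ring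
  unfold heatKernel
  rw [mul_mul_mul_comm, mul_mul_mul_comm (1 / Real.sqrt (2 * Real.pi * h) ^ d), one_div_mul_one_div, one_div_mul_one_div, ← mul_pow,
    ← mul_pow, h2, ← Real.exp_add, ← Real.exp_add]
  congr 2
  have : -‖w - (1 / 2 : ℝ) • z‖ ^ 2 / (2 * (h / 2)) + -‖w + (1 / 2 : ℝ) • z‖ ^ 2 / (2 * (h / 2))
    = -(‖w - (1 / 2 : ℝ) • z‖ ^ 2 + ‖w + (1 / 2 : ℝ) • z‖ ^ 2) / h := by field_simp; ring
  rw [this, h1]; field_simp; ring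

/-- Centred at the midpoint y − z/2, the two kernels become G_h(z) G_{h/4}(w). What remains is the
mean of a quadratic polynomial in w under a centred Gaussian of variance h/4: linear terms vanish
and the quadratic one produces h/4 a·b. -/
lemma integral_heatKernel_affine_mul {h : ℝ} (hh : 0 < h) (y z : Space d) (p q : ℝ)
    (a b : Space d) :
    ∫ x, (heatKernel d (h / 2) (x - y) * (p + inner ℝ a (x - y))) *
        (heatKernel d (h / 2) (x - (y - z)) * (q + inner ℝ b (x - (y - z))))
      = heatKernel d h z * ((p - inner ℝ a z / 2) * (q + inner ℝ b z / 2)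
          + h / 4 * inner ℝ a b) := by
  have h4 : 0 < h / 4 := by positivity
  rw [← integral_add_right_eq_self _ (y - (1 / 2 : ℝ) • z)]
  have e1 : ∀ w : Space d, w + (y - (1 / 2 : ℝ) • z) - y = w - (1 / 2 : ℝ) • z := fun w => by abel
  have e2 : ∀ w : Space d, w + (y - (1 / 2 : ℝ) • z) - (y - z) = w + (1 / 2 : ℝ) • z := fun w => by
    module
  simp_rw [e1, e2]
  set P := p - inner ℝ a z / 2
  set Q := q + inner ℝ b z / 2
  have e3 : ∀ w : Space d,
      (heatKernel d (h / 2) (w - (1 / 2 : ℝ) • z) * (p + inner ℝ a (w - (1 / 2 : ℝ) • z))) *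
        (heatKernel d (h / 2) (w + (1 / 2 : ℝ) • z) * (q + inner ℝ b (w + (1 / 2 : ℝ) • z)))
      = heatKernel d h z * ((P * Q) * heatKernel d (h / 4) w
        + heatKernel d (h / 4) w * inner ℝ (Q • a + P • b) w
        + heatKernel d (h / 4) w * (inner ℝ a w * inner ℝ b w)) := by
    intro w
    rw [mul_mul_mul_comm, heatKernel_mul_heatKernel hh]
    simp only [inner_sub_right, inner_add_right, inner_smul_right, inner_add_left,
      real_inner_smul_left, P, Q]
    ring
  simp_rw [e3]
  have i1 : Integrable fun w : Space d => heatKernel d (h / 4) w * inner ℝ (Q • a + P • b) w :=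
    integrable_mul_heatKernel h4 (by fun_prop) ‖Q • a + P • b‖ 1 fun z => by
      simpa using abs_inner_le_one_add (Q • a + P • b) z
  have i2 : Integrable fun w : Space d => heatKernel d (h / 4) w * (inner ℝ a w * inner ℝ b w) :=
    integrable_mul_heatKernel h4 (by fun_prop) (‖a‖ * ‖b‖) 2 fun z => by
      rw [abs_mul]
      calc _ ≤ (‖a‖ * (1 + ‖z‖)) * (‖b‖ * (1 + ‖z‖)) := by
            gcongr
            exacts [abs_inner_le_one_add a z, abs_inner_le_one_add b z]
        _ = _ := by ring
  have i0 := (integrable_heatKernel (d := d) h4).const_mul (P * Q)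
  rw [integral_const_mul, integral_add (by exact i0.add i1) i2, integral_add i0 i1, integral_const_mul,
    integral_heatKernel h4, integral_heatKernel_inner h4, integral_heatKernel_inner_inner h4]
  ring

/-- `∫ G_{h/2}(x - y) (α(y) + β(y)·(x - y)) b(y) dy`. -/
def gaussOp (h : ℝ) (α : Space d → ℝ) (β : Space d → Space d) (b : Space d → ℝ) (x : Space d) : ℝ :=
  ∫ y, heatKernel d (h / 2) (x - y) * (α y + inner ℝ (β y) (x - y)) * b y

/-- Measurable periodic weights bounded by `M`. -/
structure IsWeight (M : ℝ) (α : Space d → ℝ) (β : Space d → Space d) : Prop where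
  meas_fst : Measurable α
  meas_snd : Measurable β
  per_fst : TorusPeriodic α
  per_snd : TorusPeriodic β
  bound_fst : ∀ x, |α x| ≤ M
  bound_snd : ∀ x, ‖β x‖ ≤ M

lemma IsWeight.nonneg {M : ℝ} {α : Space d → ℝ} {β : Space d → Space d} (H : IsWeight M α β) :
    0 ≤ M := (norm_nonneg _).trans (H.bound_snd 0)

lemma IsWeight.abs_kernel_le {M : ℝ} {α : Space d → ℝ} {β : Space d → Space d}
    (H : IsWeight M α β) (h : ℝ) {b : Space d → ℝ} (hb : ∀ x, |b x| ≤ 1) (x y : Space d) :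
    |heatKernel d (h / 2) (x - y) * (α y + inner ℝ (β y) (x - y)) * b y|
      ≤ M * ((1 + ‖x - y‖) ^ 1 * heatKernel d (h / 2) (x - y)) := by
  have hM := H.nonneg
  rw [abs_mul, abs_mul, abs_of_nonneg (heatKernel_nonneg _ _), pow_one]
  have h1 : |α y + inner ℝ (β y) (x - y)| ≤ M * (1 + ‖x - y‖) := by
    calc _ ≤ |α y| + |inner ℝ (β y) (x - y)| := abs_add_le _ _
      _ ≤ M + M * ‖x - y‖ := add_le_add (H.bound_fst y)
          ((abs_real_inner_le_norm _ _).trans (by gcongr; exact H.bound_snd y))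
      _ = _ := by ring
  calc _ ≤ heatKernel d (h / 2) (x - y) * (M * (1 + ‖x - y‖)) * 1 := by
        refine mul_le_mul (mul_le_mul_of_nonneg_left h1 (heatKernel_nonneg _ _)) (hb y)
          (abs_nonneg _) ?_
        have := heatKernel_nonneg (d := d) (h / 2) (x - y)
        positivity
    _ = _ := by ring

lemma IsWeight.measurable_kernel {M : ℝ} {α : Space d → ℝ} {β : Space d → Space d}
    (H : IsWeight M α β) (h : ℝ) {b : Space d → ℝ} (hbm : Measurable b) :
    Measurable (fun p : Space d × Space d =>
      heatKernel d (h / 2) (p.1 - p.2) * (α p.2 + inner ℝ (β p.2) (p.1 - p.2)) * b p.2) := by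
  have := H.meas_fst; have := H.meas_snd
  have := (continuous_heatKernel (d := d) (h / 2)).measurable
  fun_prop

lemma IsWeight.measurable_gaussOp {M : ℝ} {α : Space d → ℝ} {β : Space d → Space d}
    (H : IsWeight M α β) (h : ℝ) {b : Space d → ℝ} (hbm : Measurable b) :
    Measurable (gaussOp h α β b) :=
  (H.measurable_kernel h hbm).stronglyMeasurable.integral_prod_right.measurable

lemma IsWeight.integrable_kernel {M : ℝ} {α : Space d → ℝ} {β : Space d → Space d}
    (H : IsWeight M α β) {h : ℝ} (hh : 0 < h) {b : Space d → ℝ} (hbm : Measurable b)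
    (hb : ∀ x, |b x| ≤ 1) (x : Space d) :
    Integrable (fun y => heatKernel d (h / 2) (x - y) * (α y + inner ℝ (β y) (x - y)) * b y) := by
  refine (((integrable_pow_mul_heatKernel (half_pos hh) 1).const_mul M).comp_sub_left x).mono'
    ?_ (ae_of_all _ fun y => H.abs_kernel_le h hb x y)
  exact ((H.measurable_kernel h hbm).comp measurable_prodMk_left).aestronglyMeasurable

lemma IsWeight.abs_gaussOp_le {M : ℝ} {α : Space d → ℝ} {β : Space d → Space d}
    (H : IsWeight M α β) {h : ℝ} (hh : 0 < h) {b : Space d → ℝ}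
    (hb : ∀ x, |b x| ≤ 1) (x : Space d) :
    |gaussOp h α β b x| ≤ ∫ w : Space d, M * ((1 + ‖w‖) ^ 1 * heatKernel d (h / 2) w) := by
  have i := (integrable_pow_mul_heatKernel (d := d) (half_pos hh) 1).const_mul M
  rw [← integral_sub_left_eq_self _ _ x, gaussOp, ← Real.norm_eq_abs]
  refine norm_integral_le_of_norm_le (i.comp_sub_left x) (ae_of_all _ fun y => ?_)
  exact H.abs_kernel_le h hb x y

lemma IsWeight.periodic_gaussOp {M : ℝ} {α : Space d → ℝ} {β : Space d → Space d}
    (H : IsWeight M α β) (h : ℝ) {b : Space d → ℝ} (hb : TorusPeriodic b) :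
    TorusPeriodic (gaussOp h α β b) := by
  intro i x
  unfold gaussOp
  rw [← integral_add_right_eq_self _ (EuclideanSpace.single i (1 : ℝ))]
  simp_rw [H.per_fst i _, H.per_snd i _, hb i _, add_sub_add_right_eq_sub]

/-- The `L²` pairing on the torus of two Gaussian operators is a correlation integral. -/
lemma setIntegral_gaussOp_mul_gaussOp {M : ℝ} {α α' : Space d → ℝ} {β β' : Space d → Space d}
    (H : IsWeight M α β) (H' : IsWeight M α' β') {h : ℝ} (hh : 0 < h) {a b : Space d → ℝ}
    (ham : Measurable a) (hbm : Measurable b) (ha : ∀ x, |a x| ≤ 1) (hb : ∀ x, |b x| ≤ 1)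
    (hap : TorusPeriodic a) (hbp : TorusPeriodic b) :
    ∫ x in unitCube d, gaussOp h α β a x * gaussOp h α' β' b x
      = ∫ y in unitCube d, ∫ z, heatKernel d h z * (a y * b (y - z) *
        ((α y - inner ℝ (β y) z / 2) * (α' (y - z) + inner ℝ (β' (y - z)) z / 2)
          + h / 4 * inner ℝ (β y) (β' (y - z)))) := by
  set κ : Space d → ℝ := fun w => M * ((1 + ‖w‖) ^ 1 * heatKernel d (h / 2) w)
  have iκ : Integrable κ := (integrable_pow_mul_heatKernel (half_pos hh) 1).const_mul M
  set K := ∫ w, κ w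
  have hκ0 : ∀ w, 0 ≤ κ w := fun w => by
    have := H.nonneg; have := heatKernel_nonneg (d := d) (h / 2) w; positivity
  have hK : 0 ≤ K := integral_nonneg hκ0
  have mk := H.measurable_kernel h ham
  have mk' := H'.measurable_kernel h hbm
  -- Moving the cell from x to y lets x range over all of ℝ^d, where the Gaussian moments are
  -- available.
  have step1 : ∫ x in unitCube d, gaussOp h α β a x * gaussOp h α' β' b x
      = ∫ y in unitCube d, ∫ x, heatKernel d (h / 2) (x - y) * (α y + inner ℝ (β y) (x - y)) * a y
          * gaussOp h α' β' b x := by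
    rw [← setIntegral_integral_swap (κ := fun w => κ w * K)]
    · congr 1; ext x
      rw [gaussOp, integral_mul_const]
    · exact mk.mul ((H'.measurable_gaussOp h hbm).comp measurable_fst)
    · intro i x y
      rw [H'.periodic_gaussOp h hbp i x, H.per_fst i y, H.per_snd i y, hap i y,
        add_sub_add_right_eq_sub]
    · exact iκ.mul_const K
    · intro x y
      rw [abs_mul]
      exact mul_le_mul (H.abs_kernel_le h ha x y) (H'.abs_gaussOp_le hh hb x) (abs_nonneg _)
        (hκ0 _)
  rw [step1]
  congr 1; ext y
  have iF : Integrable (fun p : Space d × Space d =>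
      (heatKernel d (h / 2) (p.1 - y) * (α y + inner ℝ (β y) (p.1 - y)) * a y)
        * (heatKernel d (h / 2) (p.1 - p.2) * (α' p.2 + inner ℝ (β' p.2) (p.1 - p.2)) * b p.2))
      (volume.prod volume) := by
    have i0 : Integrable (fun p : Space d × Space d => κ (p.1 - y) * κ (p.1 - p.2))
        (volume.prod volume) := by
      rw [integrable_prod_iff]
      · constructor
        · exact ae_of_all _ fun x => (iκ.comp_sub_left x).const_mul (κ (x - y))
        · simp_rw [norm_mul, integral_const_mul, integral_sub_left_eq_self (fun w => ‖κ w‖)]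
          exact (iκ.comp_sub_right y).norm.mul_const _
      · have : Measurable κ := by
          have := (continuous_heatKernel (d := d) (h / 2)).measurable
          fun_prop
        exact Measurable.aestronglyMeasurable (by fun_prop)
    refine i0.mono' ?_ (ae_of_all _ fun p => ?_)
    · exact ((mk.comp (measurable_fst.prodMk measurable_const)).mul mk').aestronglyMeasurable
    · rw [Real.norm_eq_abs, abs_mul]
      exact mul_le_mul (H.abs_kernel_le h ha p.1 y) (H'.abs_kernel_le h hb p.1 p.2) (abs_nonneg _)
        (hκ0 _)
  calc _ = ∫ x, ∫ y', (heatKernel d (h / 2) (x - y) * (α y + inner ℝ (β y) (x - y)) * a y)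
        * (heatKernel d (h / 2) (x - y') * (α' y' + inner ℝ (β' y') (x - y')) * b y') := by
        congr 1; ext x; rw [integral_const_mul]; rfl
    _ = ∫ y', ∫ x, (heatKernel d (h / 2) (x - y) * (α y + inner ℝ (β y) (x - y)) * a y)
        * (heatKernel d (h / 2) (x - y') * (α' y' + inner ℝ (β' y') (x - y')) * b y') :=
        integral_integral_swap iF
    _ = _ := by
        rw [← integral_sub_left_eq_self _ _ y]
        congr 1; ext z
        have e := integral_heatKernel_affine_mul hh y z (α y) (α' (y - z)) (β y) (β' (y - z))
        calc _ = ∫ x, (a y * b (y - z)) * ((heatKernel d (h / 2) (x - y) * (α y + inner ℝ (β y) (x - y))) *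
            (heatKernel d (h / 2) (x - (y - z)) * (α' (y - z) + inner ℝ (β' (y - z)) (x - (y - z))))) := by
              congr 1; ext x; ring
          _ = _ := by rw [integral_const_mul, e]; ring

/-! ### Determinants near the identity -/

/-- The trace of an endomorphism of `ℝ^d` in the standard basis. -/
def coordTrace (A : Space d →L[ℝ] Space d) : ℝ := ∑ i, A (EuclideanSpace.single i 1) i

lemma det_eq_matrix_det (A : Space d →L[ℝ] Space d) :
    A.det = Matrix.det (Matrix.of fun i j => A (EuclideanSpace.single j 1) i) := by
  rw [ContinuousLinearMap.det, ← LinearMap.det_toMatrix (EuclideanSpace.basisFun (Fin d) ℝ).toBasis]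
  congr 1

lemma contDiff_det : ContDiff ℝ 1 (fun A : Space d →L[ℝ] Space d => A.det) := by
  simp only [det_eq_matrix_det, Matrix.det_apply, Matrix.of_apply]
  refine ContDiff.sum fun σ _ => ContDiff.const_smul _ (contDiff_prod fun i _ => ?_)
  exact ((EuclideanSpace.proj (𝕜 := ℝ) (σ i)).contDiff).comp
    ((ContinuousLinearMap.apply ℝ (Space d) (EuclideanSpace.single i (1 : ℝ))).contDiff)

/-- The determinant is C¹, hence Lipschitz on the compact convex ball around the identity that
contains all the maps id + s A. -/
lemma exists_abs_det_sub_one_le (M : ℝ) : ∃ K, 0 ≤ K ∧ ∀ A : Space d →L[ℝ] Space d, ‖A‖ ≤ M →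
    ∀ s : ℝ, |s| ≤ 1 → |(ContinuousLinearMap.id ℝ (Space d) + s • A).det - 1| ≤ K * |s| := by
  obtain ⟨K, hK⟩ := (contDiff_det (d := d)).contDiffOn.exists_lipschitzOnWith one_ne_zero
    (convex_closedBall (ContinuousLinearMap.id ℝ (Space d)) |M|) (isCompact_closedBall _ _)
  refine ⟨K * |M|, by positivity, fun A hA s hs => ?_⟩
  have hA' : ‖s • A‖ ≤ |s| * |M| := by
    rw [norm_smul, Real.norm_eq_abs]; gcongr; exact hA.trans (le_abs_self M)
  have h1 := hK.dist_le_mul (ContinuousLinearMap.id ℝ (Space d) + s • A)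
    (by
      rw [mem_closedBall_iff_norm, add_sub_cancel_left]
      exact hA'.trans (mul_le_of_le_one_left (abs_nonneg _) hs))
    (ContinuousLinearMap.id ℝ (Space d)) (Metric.mem_closedBall_self (abs_nonneg _))
  rw [Real.dist_eq, dist_eq_norm, add_sub_cancel_left] at h1
  have h2 : (ContinuousLinearMap.id ℝ (Space d)).det = 1 := by
    simp [ContinuousLinearMap.det]
  rw [h2] at h1
  calc _ ≤ _ := h1
    _ ≤ K * (|s| * |M|) := by gcongr
    _ = _ := by ring

/-- As a polynomial in s, det(1 + s N) equals 1 + s tr N plus s² times a polynomial, so its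
derivative at 0 is the trace. -/
lemma hasDerivAt_det (A : Space d →L[ℝ] Space d) :
    HasDerivAt (fun s : ℝ => (ContinuousLinearMap.id ℝ (Space d) + s • A).det)
      (coordTrace A) 0 := by
  set N : Matrix (Fin d) (Fin d) ℝ := Matrix.of fun i j => A (EuclideanSpace.single j 1) i
  have h1 : ∀ s : ℝ, (ContinuousLinearMap.id ℝ (Space d) + s • A).det
      = 1 + N.trace * s + (Matrix.det
        (1 + (Polynomial.X : Polynomial ℝ) • N.map Polynomial.C)).divX.divX.eval s * s ^ 2 := by
    intro s
    rw [← Matrix.det_one_add_smul, det_eq_matrix_det]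
    congr 1; ext i j
    simp [N, Matrix.one_apply]
  simp_rw [h1]
  have h2 : N.trace = coordTrace A := by simp [N, Matrix.trace, coordTrace]
  have h3 := ((hasDerivAt_id (0 : ℝ)).const_mul N.trace).const_add 1
  have h4 := ((Matrix.det
        (1 + (Polynomial.X : Polynomial ℝ) • N.map Polynomial.C)).divX.divX.hasDerivAt 0).mul
          (hasDerivAt_pow 2 (0 : ℝ))
  exact (h3.add h4).congr_deriv (by simp [h2])

lemma abs_coordTrace_le (A : Space d →L[ℝ] Space d) : |coordTrace A| ≤ d * ‖A‖ := by
  calc _ ≤ ∑ i : Fin d, ‖A‖ := by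
        refine (Finset.abs_sum_le_sum_abs _ _).trans (Finset.sum_le_sum fun i _ => ?_)
        refine (PiLp.norm_apply_le (A (EuclideanSpace.single i 1)) i).trans ?_
        simpa using A.le_opNorm (EuclideanSpace.single i 1)
    _ = _ := by simp

/-! ### Pushing functions forward along `x ↦ x + s ξ(x)` -/

/-- Smooth periodic vector fields bounded by `M` together with their derivative. -/
structure IsField (M : ℝ) (ξ : Space d → Space d) : Prop where
  contDiff : ContDiff ℝ 1 ξ
  periodic : TorusPeriodic ξ
  bound : ∀ x, ‖ξ x‖ ≤ M
  bound_fderiv : ∀ x, ‖fderiv ℝ ξ x‖ ≤ M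

lemma IsField.nonneg {M : ℝ} {ξ : Space d → Space d} (H : IsField M ξ) : 0 ≤ M :=
  (norm_nonneg _).trans (H.bound 0)

lemma IsField.differentiable {M : ℝ} {ξ : Space d → Space d} (H : IsField M ξ) :
    Differentiable ℝ ξ := H.contDiff.differentiable one_ne_zero

lemma TorusPeriodic.fderiv {ξ : Space d → Space d} (H : TorusPeriodic ξ) :
    TorusPeriodic (fderiv ℝ ξ) := by
  intro i x
  have : ξ = fun y => ξ (y + EuclideanSpace.single i 1) := funext fun y => (H i y).symm
  conv_rhs => rw [this]
  rw [fderiv_comp_add_right]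

/-- The field ξ is M-Lipschitz, so the map is a perturbation of the identity with Lipschitz constant
|s| M < 1 and therefore globally invertible. -/
lemma IsField.exists_homeomorph {M : ℝ} {ξ : Space d → Space d} (H : IsField M ξ) {s : ℝ}
    (hs : |s| * M < 1) : ∃ e : Space d ≃ₜ Space d, ∀ x, e x = x + s • ξ x := by
  have hM := H.nonneg
  have hl : ∀ x y, ‖ξ x - ξ y‖ ≤ M * ‖x - y‖ := fun x y =>
    Convex.norm_image_sub_le_of_norm_fderiv_le (fun z _ => H.differentiable z)
      (fun z _ => H.bound_fderiv z) convex_univ (mem_univ y) (mem_univ x)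
  have ha : ApproximatesLinearOn (fun x => x + s • ξ x)
      (ContinuousLinearEquiv.refl ℝ (Space d) : Space d →L[ℝ] Space d) univ
      (|s| * M).toNNReal := by
    intro x _ y _
    have : x + s • ξ x - (y + s • ξ y)
      - (ContinuousLinearEquiv.refl ℝ (Space d) : Space d →L[ℝ] Space d) (x - y)
        = s • (ξ x - ξ y) := by
      simp only [ContinuousLinearEquiv.coe_refl, ContinuousLinearMap.id_apply, smul_sub]; abel
    rw [this, norm_smul, Real.norm_eq_abs]
    rw [Real.coe_toNNReal _ (by positivity), mul_assoc]
    gcongr; exact hl x y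
  refine ⟨ha.toHomeomorph _ ?_, fun x => rfl⟩
  rcases subsingleton_or_nontrivial (Space d) with h | h
  · exact Or.inl h
  · right
    have : ‖((ContinuousLinearEquiv.refl ℝ (Space d)).symm : Space d →L[ℝ] Space d)‖₊ = 1 := by
      simp
    rw [this, inv_one]
    exact Real.toNNReal_lt_one.2 hs

/-- The function `b` transported by `x ↦ x + s ξ(x)`. -/
def transport (ξ : Space d → Space d) (s : ℝ) (b : Space d → ℝ) (y : Space d) : ℝ :=
  b (Function.invFun (fun x => x + s • ξ x) y)

/-- Using `Function.invFun` keeps `transport` defined for every s; it is the true inverse whenever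
the map is a homeomorphism. -/
lemma transport_eq {ξ : Space d → Space d} {s : ℝ} {e : Space d ≃ₜ Space d}
    (he : ∀ x, e x = x + s • ξ x) (b : Space d → ℝ) (y : Space d) :
    transport ξ s b y = b (e.symm y) := by
  have : (fun x => x + s • ξ x) = e := funext fun x => (he x).symm
  rw [transport, this]
  congr 1
  apply e.injective
  rw [e.apply_symm_apply]
  exact Function.invFun_eq ⟨e.symm y, e.apply_symm_apply y⟩

lemma IsField.measurable_transport {M : ℝ} {ξ : Space d → Space d} (H : IsField M ξ) {s : ℝ}
    (hs : |s| * M < 1) {b : Space d → ℝ} (hb : Measurable b) : Measurable (transport ξ s b) := by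
  obtain ⟨e, he⟩ := H.exists_homeomorph hs
  rw [show transport ξ s b = fun y => b (e.symm y) from funext (transport_eq he b)]
  exact hb.comp e.symm.continuous.measurable

lemma IsField.periodic_transport {M : ℝ} {ξ : Space d → Space d} (H : IsField M ξ) {s : ℝ}
    (hs : |s| * M < 1) {b : Space d → ℝ} (hb : TorusPeriodic b) :
    TorusPeriodic (transport ξ s b) := by
  obtain ⟨e, he⟩ := H.exists_homeomorph hs
  intro i y
  rw [transport_eq he, transport_eq he, ← hb i (e.symm y)]
  congr 1
  apply e.injective
  rw [e.apply_symm_apply, he, H.periodic i, add_right_comm, ← he, e.apply_symm_apply]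

lemma IsField.transport_mem {M : ℝ} {ξ : Space d → Space d} (H : IsField M ξ) {s : ℝ}
    (hs : |s| * M < 1) {u : Space d → ℝ} (hu : u ∈ configSpace d) :
    transport ξ s u ∈ configSpace d :=
  ⟨H.measurable_transport hs hu.1, H.periodic_transport hs hu.2.1, fun _ => hu.2.2 _⟩

/-- The change of variables moves the dependence on s from `b`, which is later only measurable, to
the factor `f`, which is later the smooth kernel. This is why transports of rough functions can be
differentiated. -/
lemma IsField.integral_mul_transport {M : ℝ} {ξ : Space d → Space d} (H : IsField M ξ) {s : ℝ}
    (hs : |s| * M < 1) (f b : Space d → ℝ) :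
    ∫ y, f y * transport ξ s b y
      = ∫ y, |(ContinuousLinearMap.id ℝ (Space d) + s • fderiv ℝ ξ y).det|
          * (f (y + s • ξ y) * b y) := by
  obtain ⟨e, he⟩ := H.exists_homeomorph hs
  have h1 := integral_image_eq_integral_abs_det_fderiv_smul volume (f := e) MeasurableSet.univ
    (f' := fun y => ContinuousLinearMap.id ℝ (Space d) + s • fderiv ℝ ξ y)
    (fun x _ => by
      rw [show (e : Space d → Space d) = fun x => x + s • ξ x from funext he]
      exact ((hasFDerivAt_id x).add
        ((H.differentiable x).hasFDerivAt.const_smul s)).hasFDerivWithinAt)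
    e.injective.injOn (fun y => f y * transport ξ s b y)
  rw [image_univ, e.range_coe, Measure.restrict_univ] at h1
  rw [h1]
  congr 1; ext y
  rw [transport_eq he, e.symm_apply_apply, he, smul_eq_mul]

/-! ### The first variation of Gaussian averages -/

/-- From |w|² ≤ 2|w − v|² + 2M²: doubling the variance pays for any shift bounded by M. The majorant
does not depend on the shift; its constant degenerates as h → 0, but it serves only at fixed h. -/
lemma heatKernel_half_sub_le {h M : ℝ} (hh : 0 < h) (w v : Space d) (hv : ‖v‖ ≤ M) :
    heatKernel d (h / 2) (w - v)
      ≤ Real.sqrt 2 ^ d * Real.exp (M ^ 2 / h) * heatKernel d h w := by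
  have h1 : Real.sqrt (2 * Real.pi * h) = Real.sqrt 2 * Real.sqrt (2 * Real.pi * (h / 2)) := by
    rw [← Real.sqrt_mul (by norm_num)]; congr 1; ring
  have h2 : 0 < Real.sqrt (2 * Real.pi * (h / 2)) := Real.sqrt_pos.2 (by positivity)
  have h0 : ‖w‖ ^ 2 ≤ 2 * ‖w - v‖ ^ 2 + 2 * M ^ 2 := by
    have h3 : ‖w‖ ≤ ‖w - v‖ + ‖v‖ := by simpa using norm_add_le (w - v) v
    have h4 : ‖w‖ ≤ ‖w - v‖ + M := by linarith
    have h5 : ‖w‖ ^ 2 ≤ (‖w - v‖ + M) ^ 2 := by gcongr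
    nlinarith [sq_nonneg (‖w - v‖ - M)]
  have h6 : Real.exp (-(‖w - v‖ ^ 2) / (2 * (h / 2)))
      ≤ Real.exp (M ^ 2 / h) * Real.exp (-(‖w‖ ^ 2) / (2 * h)) := by
    rw [← Real.exp_add]
    refine Real.exp_le_exp.2 ?_
    have : M ^ 2 / h + -(‖w‖ ^ 2) / (2 * h) - -(‖w - v‖ ^ 2) / (2 * (h / 2))
      = (2 * ‖w - v‖ ^ 2 + 2 * M ^ 2 - ‖w‖ ^ 2) / (2 * h) := by field_simp; ring
    have h7 : 0 ≤ (2 * ‖w - v‖ ^ 2 + 2 * M ^ 2 - ‖w‖ ^ 2) / (2 * h) :=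
      div_nonneg (by linarith) (by positivity)
    linarith
  unfold heatKernel
  rw [h1, mul_pow]
  calc _ ≤ 1 / Real.sqrt (2 * Real.pi * (h / 2)) ^ d *
        (Real.exp (M ^ 2 / h) * Real.exp (-(‖w‖ ^ 2) / (2 * h))) := by gcongr
    _ = _ := by field_simp

lemma abs_exp_sub_exp_le (a b : ℝ) :
    |Real.exp a - Real.exp b| ≤ |a - b| * (Real.exp a + Real.exp b) := by
  wlog hab : b ≤ a generalizing a b
  · rw [abs_sub_comm, abs_sub_comm a, add_comm]; exact this b a (le_of_not_ge hab)
  rw [abs_of_nonneg (sub_nonneg.2 (Real.exp_le_exp.2 hab)), abs_of_nonneg (sub_nonneg.2 hab)]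
  have h1 : Real.exp b = Real.exp a * Real.exp (b - a) := by rw [← Real.exp_add]; congr 1; ring
  have h2 := Real.add_one_le_exp (b - a)
  have h3 := Real.exp_pos a
  have h4 := Real.exp_pos b
  nlinarith [mul_nonneg (sub_nonneg.2 hab) h4.le]

lemma abs_heatKernel_half_sub_le {h : ℝ} (hh : 0 < h) (w v : Space d) :
    |heatKernel d (h / 2) (w - v) - heatKernel d (h / 2) w|
      ≤ (2 * ‖w‖ + ‖v‖) * ‖v‖ / h * (heatKernel d (h / 2) (w - v) + heatKernel d (h / 2) w) := by
  set c := 1 / Real.sqrt (2 * Real.pi * (h / 2)) ^ d with hc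
  have hc0 : 0 ≤ c := by positivity
  have h1 := abs_exp_sub_exp_le (-(‖w - v‖ ^ 2) / (2 * (h / 2))) (-(‖w‖ ^ 2) / (2 * (h / 2)))
  have h2 : |-(‖w - v‖ ^ 2) / (2 * (h / 2)) - -(‖w‖ ^ 2) / (2 * (h / 2))|
      ≤ (2 * ‖w‖ + ‖v‖) * ‖v‖ / h := by
    have : -(‖w - v‖ ^ 2) / (2 * (h / 2)) - -(‖w‖ ^ 2) / (2 * (h / 2))
      = (2 * inner ℝ w v - ‖v‖ ^ 2) / h := by
      rw [norm_sub_sq_real]; field_simp; ring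
    rw [this, abs_div, abs_of_pos hh]
    gcongr
    have h3 := abs_real_inner_le_norm w v
    rw [abs_le] at h3 ⊢
    constructor <;> nlinarith [norm_nonneg v, norm_nonneg w]
  unfold heatKernel
  rw [← hc, ← mul_sub, abs_mul, abs_of_nonneg hc0]
  calc _ ≤ c * ((2 * ‖w‖ + ‖v‖) * ‖v‖ / h * (Real.exp (-(‖w - v‖ ^ 2) / (2 * (h / 2)))
        + Real.exp (-(‖w‖ ^ 2) / (2 * (h / 2))))) := by
        gcongr
        exact h1.trans (by gcongr)
    _ = _ := by ring

/-- The Gaussian average `G_{h/2} * b`. -/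
def smoothing (h : ℝ) (b : Space d → ℝ) : Space d → ℝ :=
  gaussOp h (fun _ => 1) (fun _ => 0) b

/-- The derivative of the Gaussian average along the transport by `ξ`. -/
def variation (h : ℝ) (ξ : Space d → Space d) (b : Space d → ℝ) : Space d → ℝ :=
  gaussOp h (fun y => coordTrace (fderiv ℝ ξ y)) (fun y => (2 / h) • ξ y) b

lemma smoothing_apply (h : ℝ) (b : Space d → ℝ) (x : Space d) :
    smoothing h b x = ∫ y, heatKernel d (h / 2) (x - y) * b y := by
  simp [smoothing, gaussOp]

lemma heatConv_half_eq_smoothing (h : ℝ) (b : Space d → ℝ) : heatConv (h / 2) b = smoothing h b := by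
  ext x
  rw [smoothing_apply, heatConv, ← integral_sub_left_eq_self _ _ x]
  simp

lemma isWeight_one : IsWeight (d := d) 1 (fun _ => 1) (fun _ => 0) :=
  ⟨measurable_const, measurable_const, fun _ _ => rfl, fun _ _ => rfl, by simp, by simp⟩

lemma IsField.isWeight {M : ℝ} {ξ : Space d → Space d} (H : IsField M ξ) {h : ℝ} (hh : 0 < h) :
    IsWeight (d * M + 2 / h * M) (fun y => coordTrace (fderiv ℝ ξ y)) (fun y => (2 / h) • ξ y) := by
  have hM := H.nonneg
  have hc : Continuous (fderiv ℝ ξ) := H.contDiff.continuous_fderiv one_ne_zero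
  refine ⟨?_, ?_, ?_, ?_, fun x => ?_, fun x => ?_⟩
  · unfold coordTrace
    exact (continuous_finsetSum _ fun i _ => (EuclideanSpace.proj (𝕜 := ℝ) i).continuous.comp
      (hc.clm_apply continuous_const)).measurable
  · exact (H.contDiff.continuous.const_smul (2 / h)).measurable
  · intro i x; simp only [H.periodic.fderiv i x]
  · intro i x; simp only [H.periodic i x]
  · have h1 := (abs_coordTrace_le (fderiv ℝ ξ x)).trans
      (mul_le_mul_of_nonneg_left (H.bound_fderiv x) (Nat.cast_nonneg d))
    have : 0 ≤ 2 / h * M := by positivity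
    linarith
  · rw [norm_smul, Real.norm_of_nonneg (by positivity)]
    have h1 : 2 / h * ‖ξ x‖ ≤ 2 / h * M := by gcongr; exact H.bound x
    have : 0 ≤ d * M := by positivity
    linarith

lemma integrable_heatKernel_mul_of_abs_le_one {h : ℝ} (hh : 0 < h) {b : Space d → ℝ}
    (hbm : Measurable b) (hb : ∀ x, |b x| ≤ 1) (x : Space d) :
    Integrable (fun y => heatKernel d (h / 2) (x - y) * b y) := by
  simpa using isWeight_one.integrable_kernel hh hbm hb x

/-- The transported average is the average with the transported kernel. -/
lemma IsField.smoothing_transport_sub {M : ℝ} {ξ : Space d → Space d} (H : IsField M ξ) {s : ℝ}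
    (hs : |s| * M < 1) {h : ℝ} (hh : 0 < h) {b : Space d → ℝ} (hbm : Measurable b)
    (hb : ∀ x, |b x| ≤ 1) (x : Space d) :
    smoothing h (transport ξ s b) x - smoothing h b x
      = ∫ y, (|(ContinuousLinearMap.id ℝ (Space d) + s • fderiv ℝ ξ y).det|
          * heatKernel d (h / 2) (x - y - s • ξ y) - heatKernel d (h / 2) (x - y)) * b y := by
  rw [smoothing_apply, smoothing_apply, H.integral_mul_transport hs]
  have i1 := integrable_heatKernel_mul_of_abs_le_one hh hbm hb x
  have i2 : Integrable fun y => |(ContinuousLinearMap.id ℝ (Space d) + s • fderiv ℝ ξ y).det|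
      * (heatKernel d (h / 2) (x - (y + s • ξ y)) * b y) := by
    obtain ⟨e, he⟩ := H.exists_homeomorph hs
    have h1 := integrableOn_image_iff_integrableOn_abs_det_fderiv_smul volume (f := e)
      MeasurableSet.univ
      (f' := fun y => ContinuousLinearMap.id ℝ (Space d) + s • fderiv ℝ ξ y)
      (fun x _ => by
        rw [show (e : Space d → Space d) = fun x => x + s • ξ x from funext he]
        exact ((hasFDerivAt_id x).add
          ((H.differentiable x).hasFDerivAt.const_smul s)).hasFDerivWithinAt)
      e.injective.injOn (fun y => heatKernel d (h / 2) (x - y) * transport ξ s b y)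
    rw [image_univ, e.range_coe, integrableOn_univ, integrableOn_univ] at h1
    refine (h1.1 (integrable_heatKernel_mul_of_abs_le_one hh (H.measurable_transport hs hbm)
      (fun _ => hb _) x)).congr (ae_of_all _ fun y => ?_)
    beta_reduce
    rw [transport_eq he, e.symm_apply_apply, smul_eq_mul, he]
  rw [← integral_sub i2 i1]
  congr 1; ext y
  rw [sub_add_eq_sub_sub]; ring

/-- Uniform estimate for the transported kernel. -/
lemma IsField.exists_kernel_bound {M : ℝ} {ξ : Space d → Space d} (H : IsField M ξ) {h : ℝ}
    (hh : 0 < h) : ∃ C, 0 ≤ C ∧ ∀ s : ℝ, |s| ≤ 1 → ∀ y w : Space d,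
      |(|(ContinuousLinearMap.id ℝ (Space d) + s • fderiv ℝ ξ y).det|
          * heatKernel d (h / 2) (w - s • ξ y) - heatKernel d (h / 2) w)|
        ≤ |s| * (C * ((1 + ‖w‖) ^ 1 * heatKernel d h w)) := by
  have hM := H.nonneg
  obtain ⟨K, hK0, hK⟩ := exists_abs_det_sub_one_le (d := d) M
  set B := Real.sqrt 2 ^ d * Real.exp (M ^ 2 / h)
  have hB : 0 ≤ B := by positivity
  refine ⟨K * B + (2 + M) * M / h * (2 * B), by positivity, fun s hs y w => ?_⟩
  set v := s • ξ y
  have hv : ‖v‖ ≤ |s| * M := by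
    rw [norm_smul, Real.norm_eq_abs]; gcongr; exact H.bound y
  have hvM : ‖v‖ ≤ M := hv.trans (mul_le_of_le_one_left hM hs)
  have h1 := heatKernel_half_sub_le hh w v hvM
  have h1' := heatKernel_half_sub_le hh w 0 (by simpa using hM)
  rw [sub_zero] at h1'
  have h2 := abs_heatKernel_half_sub_le hh w v
  set D := (ContinuousLinearMap.id ℝ (Space d) + s • fderiv ℝ ξ y).det
  have h3 : |(|D| - 1)| ≤ K * |s| := by
    have := abs_abs_sub_abs_le D 1
    rw [abs_one] at this
    exact this.trans (hK _ (H.bound_fderiv y) s hs)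
  have g0 := heatKernel_nonneg (d := d) h w
  have g1 := heatKernel_nonneg (d := d) (h / 2) (w - v)
  have h4 : (2 * ‖w‖ + ‖v‖) * ‖v‖ / h ≤ |s| * ((2 + M) * M / h * (1 + ‖w‖)) := by
    calc _ ≤ (2 * ‖w‖ + M) * (|s| * M) / h := by gcongr
      _ ≤ ((2 + M) * (1 + ‖w‖)) * (|s| * M) / h := by
        gcongr; nlinarith [norm_nonneg w, mul_nonneg hM (norm_nonneg w)]
      _ = _ := by ring
  have e1 : |D| * heatKernel d (h / 2) (w - v) - heatKernel d (h / 2) w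
      = (|D| - 1) * heatKernel d (h / 2) (w - v)
        + (heatKernel d (h / 2) (w - v) - heatKernel d (h / 2) w) := by ring
  rw [e1]
  calc _ ≤ |(|D| - 1)| * heatKernel d (h / 2) (w - v)
        + |heatKernel d (h / 2) (w - v) - heatKernel d (h / 2) w| := by
        refine (abs_add_le _ _).trans ?_
        rw [abs_mul, abs_of_nonneg g1]
    _ ≤ K * |s| * (B * heatKernel d h w)
        + |s| * ((2 + M) * M / h * (1 + ‖w‖)) * (B * heatKernel d h w + B * heatKernel d h w) := by
        refine add_le_add (by gcongr) (h2.trans ?_)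
        exact mul_le_mul h4 (add_le_add h1 h1') (add_nonneg g1 (heatKernel_nonneg _ _))
          (by positivity)
    _ = |s| * ((K * B * 1 + (2 + M) * M / h * (2 * B) * (1 + ‖w‖)) * heatKernel d h w) := by ring
    _ ≤ |s| * ((K * B * (1 + ‖w‖) + (2 + M) * M / h * (2 * B) * (1 + ‖w‖))
          * heatKernel d h w) := by
        gcongr; simp
    _ = _ := by ring

/-- Being uniform in x, this bound supplies the constant majorant when difference quotients of
energy and distance are integrated over the cell. -/
lemma IsField.exists_abs_smoothing_transport_sub_le {M : ℝ} {ξ : Space d → Space d}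
    (H : IsField M ξ) {h : ℝ} (hh : 0 < h) : ∃ C, 0 ≤ C ∧ ∀ s : ℝ, |s| ≤ 1 → |s| * M < 1 →
      ∀ b : Space d → ℝ, Measurable b → (∀ x, |b x| ≤ 1) → ∀ x,
        |smoothing h (transport ξ s b) x - smoothing h b x| ≤ C * |s| := by
  obtain ⟨C, hC0, hC⟩ := H.exists_kernel_bound hh
  have i0 := (integrable_pow_mul_heatKernel (d := d) hh 1).const_mul C
  refine ⟨∫ w : Space d, C * ((1 + ‖w‖) ^ 1 * heatKernel d h w),
    integral_nonneg fun w => ?_, fun s hs hsM b hbm hb x => ?_⟩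
  · have := heatKernel_nonneg (d := d) h w
    positivity
  rw [H.smoothing_transport_sub hsM hh hbm hb, mul_comm, ← integral_const_mul,
    ← integral_sub_left_eq_self (fun w => |s| * (C * ((1 + ‖w‖) ^ 1 * heatKernel d h w))) _ x,
    ← Real.norm_eq_abs (∫ _, _)]
  refine norm_integral_le_of_norm_le ((i0.const_mul |s|).comp_sub_left x) (ae_of_all _ fun y => ?_)
  rw [norm_mul]
  exact (mul_le_of_le_one_right (norm_nonneg _) (hb y)).trans (hC s hs y (x - y))

lemma eventually_small (M : ℝ) : ∀ᶠ s : ℝ in 𝓝 0, |s| ≤ 1 ∧ |s| * M < 1 := by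
  have h1 : Tendsto (fun s : ℝ => |s| * M) (𝓝 0) (𝓝 0) := by
    have : Continuous fun s : ℝ => |s| * M := by fun_prop
    simpa using this.tendsto 0
  have h2 : Tendsto (fun s : ℝ => |s|) (𝓝 0) (𝓝 0) := by simpa using continuous_abs.tendsto (0 : ℝ)
  filter_upwards [h1.eventually (gt_mem_nhds one_pos), h2.eventually (gt_mem_nhds one_pos)]
    with s a b using ⟨b.le, a⟩

/-- Differentiate |det(id + s∇ξ)| G_{h/2}(x − y − sξ(y)) under the integral at s = 0: the Jacobian
contributes ∇·ξ, the kernel contributes (2/h) ξ·(x − y). These are exactly the weights in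
`variation`. -/
lemma IsField.tendsto_smoothing_transport {M : ℝ} {ξ : Space d → Space d} (H : IsField M ξ)
    {h : ℝ} (hh : 0 < h) {b : Space d → ℝ} (hbm : Measurable b) (hb : ∀ x, |b x| ≤ 1)
    (x : Space d) :
    Tendsto (fun s => (smoothing h (transport ξ s b) x - smoothing h b x) / s) (𝓝[>] 0)
      (𝓝 (variation h ξ b x)) := by
  obtain ⟨C, hC0, hC⟩ := H.exists_kernel_bound hh
  have hcd : Continuous (fderiv ℝ ξ) := H.contDiff.continuous_fderiv one_ne_zero
  have hcg := continuous_heatKernel (d := d) (h / 2)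
  have hev := eventually_small M
  have small : ∀ᶠ s : ℝ in 𝓝[>] 0, (|s| ≤ 1 ∧ |s| * M < 1) ∧ 0 < s :=
    (hev.filter_mono nhdsWithin_le_nhds).and self_mem_nhdsWithin
  have e1 : ∀ᶠ s : ℝ in 𝓝[>] 0,
      ∫ y, ((|(ContinuousLinearMap.id ℝ (Space d) + s • fderiv ℝ ξ y).det|
          * heatKernel d (h / 2) (x - y - s • ξ y) - heatKernel d (h / 2) (x - y)) * b y) / s
      = (smoothing h (transport ξ s b) x - smoothing h b x) / s := by
    filter_upwards [small] with s hs
    rw [H.smoothing_transport_sub hs.1.2 hh hbm hb, integral_div]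
  refine Tendsto.congr' e1 ?_
  refine tendsto_integral_filter_of_dominated_convergence
    (fun y => C * ((1 + ‖x - y‖) ^ 1 * heatKernel d h (x - y))) ?_ ?_ ?_ ?_
  · refine Eventually.of_forall fun s => ?_
    have hcξ := H.contDiff.continuous
    have hdet : Continuous fun y =>
        (ContinuousLinearMap.id ℝ (Space d) + s • fderiv ℝ ξ y).det :=
      (contDiff_det (d := d)).continuous.comp (by fun_prop)
    exact (((by fun_prop : Continuous fun y =>
      |(ContinuousLinearMap.id ℝ (Space d) + s • fderiv ℝ ξ y).det|
          * heatKernel d (h / 2) (x - y - s • ξ y)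
          - heatKernel d (h / 2) (x - y)).measurable.mul hbm).div_const s).aestronglyMeasurable
  · filter_upwards [small] with s hs
    refine ae_of_all _ fun y => ?_
    have h1 := hC s hs.1.1 y (x - y)
    rw [norm_div, norm_mul, Real.norm_eq_abs, Real.norm_eq_abs, Real.norm_eq_abs,
      div_le_iff₀ (abs_pos.2 hs.2.ne'), mul_comm _ |s|]
    exact (mul_le_of_le_one_right (abs_nonneg _) (hb y)).trans h1
  · exact ((integrable_pow_mul_heatKernel (d := d) hh 1).const_mul C).comp_sub_left x
  · refine ae_of_all _ fun y => ?_
    have d1 := hasDerivAt_det (fderiv ℝ ξ y)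
    have d1' : HasDerivAt (fun s : ℝ =>
        |(ContinuousLinearMap.id ℝ (Space d) + s • fderiv ℝ ξ y).det|)
        (coordTrace (fderiv ℝ ξ y)) 0 := by
      refine d1.congr_of_eventuallyEq ?_
      have : ∀ᶠ s : ℝ in 𝓝 0,
          0 < (ContinuousLinearMap.id ℝ (Space d) + s • fderiv ℝ ξ y).det := by
        refine d1.continuousAt.eventually (lt_mem_nhds ?_)
        simp [ContinuousLinearMap.det]
      filter_upwards [this] with s hs using abs_of_pos hs
    have d2 : HasDerivAt (fun s : ℝ => heatKernel d (h / 2) (x - y - s • ξ y))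
        (-(inner ℝ (-ξ y) (x - y) / (h / 2)) * heatKernel d (h / 2) (x - y)) 0 := by
      have := hasLineDerivAt_heatKernel (h / 2) (-ξ y) (x - y)
      rw [HasLineDerivAt] at this
      simpa only [smul_neg, ← sub_eq_add_neg] using this
    have d3 := ((d1'.mul d2).mul_const (b y)).tendsto_slope_zero_right
    have h0 : (ContinuousLinearMap.id ℝ (Space d) + (0 : ℝ) • fderiv ℝ ξ y).det = 1 := by
      simp [ContinuousLinearMap.det]
    refine (d3.congr' ?_).trans (le_of_eq ?_)
    · filter_upwards with s
      simp only [zero_add, Pi.mul_apply, h0, zero_smul, sub_zero, abs_one, one_mul,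
        smul_eq_mul]
      ring
    · congr 1
      simp only [h0, zero_smul, sub_zero, abs_one, one_mul, inner_neg_left,
        real_inner_smul_left]
      field_simp

/-! ### The metric slope along a curve -/

/-- Since D > 0, the curve approaches `u` at strictly positive distance and so is admissible in the
limsup; in the quotient of the two difference quotients the factors s cancel. -/
lemma le_metricSlope_of_curve {α : Type*} {M : Set α} {dist : α → α → ℝ} {E : α → ℝ} {u : α}
    {v : ℝ → α} {L D : ℝ} (hv : ∀ᶠ s in 𝓝[>] (0 : ℝ), v s ∈ M)
    (hd : Tendsto (fun s => dist (v s) u / s) (𝓝[>] 0) (𝓝 D))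
    (hE : Tendsto (fun s => (E u - E (v s)) / s) (𝓝[>] 0) (𝓝 L)) (hD : 0 < D) :
    ENNReal.ofReal L / ENNReal.ofReal D ≤ metricSlope M dist E u := by
  have hpos : ∀ᶠ s : ℝ in 𝓝[>] 0, 0 < s := self_mem_nhdsWithin
  have hid : Tendsto (fun s : ℝ => s) (𝓝[>] 0) (𝓝 0) := tendsto_id.mono_left nhdsWithin_le_nhds
  have h1 : Tendsto (fun s => dist (v s) u) (𝓝[>] 0) (𝓝[>] 0) := by
    refine tendsto_nhdsWithin_iff.2 ⟨?_, ?_⟩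
    · have h0 := hd.mul hid
      rw [mul_zero] at h0
      refine h0.congr' ?_
      filter_upwards [hpos] with s hs using div_mul_cancel₀ _ hs.ne'
    · filter_upwards [hpos, hd.eventually (lt_mem_nhds hD)] with s hs h
      exact (div_pos_iff_of_pos_right hs).1 h
  have h2 : Tendsto v (𝓝[>] 0) (comap (fun v => dist v u) (𝓝[>] (0 : ℝ)) ⊓ 𝓟 M) :=
    tendsto_inf.2 ⟨tendsto_comap_iff.2 h1, tendsto_principal.2 hv⟩
  refine le_trans (le_of_eq ?_) h2.limsup_comp_le_limsup
  have h3 : Tendsto (fun s => ENNReal.ofReal ((E u - E (v s)) / s)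
      / ENNReal.ofReal (dist (v s) u / s)) (𝓝[>] 0) (𝓝 (ENNReal.ofReal L / ENNReal.ofReal D)) :=
    ENNReal.Tendsto.div ((ENNReal.continuous_ofReal.tendsto _).comp hE) (Or.inr (by simpa using hD))
      ((ENNReal.continuous_ofReal.tendsto _).comp hd) (Or.inl (by simp))
  refine ((h3.congr' ?_).limsup_eq).symm
  filter_upwards [hpos] with s hs
  rw [Function.comp_apply, ENNReal.ofReal_div_of_pos hs, ENNReal.ofReal_div_of_pos hs,
    div_eq_mul_inv, div_eq_mul_inv, div_eq_mul_inv _ (ENNReal.ofReal s),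
    ENNReal.mul_inv (Or.inr (by simp [hs])) (Or.inr (by simp)), inv_inv, mul_mul_mul_comm,
    ENNReal.inv_mul_cancel (by simpa using hs) (by simp), mul_one, div_eq_mul_inv]

/-- Young's inequality: L ≤ aD implies L ≤ a²/2 + D²/2. -/
lemma ofReal_sub_le_half_sq {a : ℝ≥0∞} {L D : ℝ} (hD : 0 < D)
    (h : ENNReal.ofReal L / ENNReal.ofReal D ≤ a) :
    ENNReal.ofReal (L - D ^ 2 / 2) ≤ 1 / 2 * a ^ 2 := by
  rcases eq_or_ne a ⊤ with rfl | ha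
  · simp
  lift a to NNReal using ha
  rw [ENNReal.div_le_iff (by simpa using hD) (by simp), ← ENNReal.ofReal_coe_nnreal,
    ← ENNReal.ofReal_mul a.coe_nonneg, ENNReal.ofReal_le_ofReal_iff (by positivity)] at h
  rw [← ENNReal.ofReal_coe_nnreal, ← ENNReal.ofReal_pow a.coe_nonneg,
    show (1 / 2 : ℝ≥0∞) = ENNReal.ofReal (1 / 2) by
      rw [ENNReal.ofReal_div_of_pos two_pos]; simp, ← ENNReal.ofReal_mul (by norm_num)]
  refine ENNReal.ofReal_le_ofReal ?_
  nlinarith [sq_nonneg ((a : ℝ) - D)]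

/-! ### Energy and distance in terms of Gaussian averages -/

lemma abs_le_one_of_mem {u : Space d → ℝ} (hu : u ∈ configSpace d) (x : Space d) : |u x| ≤ 1 := by
  rw [abs_of_nonneg (hu.2.2 x).1]; exact (hu.2.2 x).2

lemma one_sub_mem {u : Space d → ℝ} (hu : u ∈ configSpace d) :
    (fun x => 1 - u x) ∈ configSpace d := by
  refine ⟨measurable_const.sub hu.1, fun i x => ?_, fun x => ⟨?_, ?_⟩⟩
  · simp only [hu.2.1 i x]
  · linarith [(hu.2.2 x).2]
  · linarith [(hu.2.2 x).1]

lemma smoothing_sub {h : ℝ} (hh : 0 < h) {u v : Space d → ℝ} (hu : Measurable u)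
    (hv : Measurable v) (hu1 : ∀ x, |u x| ≤ 1) (hv1 : ∀ x, |v x| ≤ 1) (x : Space d) :
    smoothing h (fun y => u y - v y) x = smoothing h u x - smoothing h v x := by
  simp only [smoothing_apply, mul_sub]
  exact integral_sub (integrable_heatKernel_mul_of_abs_le_one hh hu hu1 x)
    (integrable_heatKernel_mul_of_abs_le_one hh hv hv1 x)

lemma smoothing_one_sub {h : ℝ} (hh : 0 < h) {u : Space d → ℝ} (hu : u ∈ configSpace d)
    (x : Space d) : smoothing h (fun y => 1 - u y) x = 1 - smoothing h u x := by
  rw [smoothing_sub hh measurable_const hu.1 (by simp) (abs_le_one_of_mem hu)]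
  congr 1
  simp only [smoothing_apply, mul_one]
  rw [integral_sub_left_eq_self (fun w => heatKernel d (h / 2) w),
    integral_heatKernel (half_pos hh)]

/-- This is the semigroup property G_h = G_{h/2} * G_{h/2} in symmetric form; it expresses the
energy through the same average that defines the distance. -/
lemma energy_eq {h : ℝ} (hh : 0 < h) {u : Space d → ℝ} (hu : u ∈ configSpace d) :
    energy h u = 1 / Real.sqrt h *
      ∫ x in unitCube d, (1 - smoothing h u x) * smoothing h u x := by
  have hu' := one_sub_mem hu
  have := setIntegral_gaussOp_mul_gaussOp isWeight_one isWeight_one hh hu'.1 hu.1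
    (abs_le_one_of_mem hu') (abs_le_one_of_mem hu) hu'.2.1 hu.2.1
  simp only [← smoothing_one_sub hh hu]
  unfold smoothing energy
  rw [this]
  congr 2; ext x
  rw [heatConv, ← integral_const_mul]
  congr 1; ext z
  simp; ring

lemma configDist_eq {h : ℝ} (hh : 0 < h) {u v : Space d → ℝ} (hu : u ∈ configSpace d)
    (hv : v ∈ configSpace d) :
    configDist h u v = Real.sqrt (2 * Real.sqrt h *
      ∫ x in unitCube d, (smoothing h u x - smoothing h v x) ^ 2) := by
  unfold configDist
  simp only [heatConv_half_eq_smoothing,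
    smoothing_sub hh hu.1 hv.1 (abs_le_one_of_mem hu) (abs_le_one_of_mem hv)]

lemma integrableOn_unitCube_of_abs_le {f : Space d → ℝ} (hf : Measurable f) (C : ℝ)
    (hC : ∀ x, |f x| ≤ C) : IntegrableOn f (unitCube d) :=
  (integrable_const C).mono' hf.aestronglyMeasurable (ae_of_all _ hC)

lemma exists_abs_smoothing_le {h : ℝ} (hh : 0 < h) : ∃ B, ∀ u ∈ configSpace d, ∀ x,
    |smoothing h u x| ≤ B :=
  ⟨_, fun _ hu x => isWeight_one.abs_gaussOp_le hh (abs_le_one_of_mem hu) x⟩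

lemma measurable_smoothing (h : ℝ) {u : Space d → ℝ} (hu : Measurable u) :
    Measurable (smoothing h u) := isWeight_one.measurable_gaussOp h hu

lemma IsField.measurable_variation {M : ℝ} {ξ : Space d → Space d} (H : IsField M ξ) {h : ℝ}
    (hh : 0 < h) {u : Space d → ℝ} (hu : Measurable u) : Measurable (variation h ξ u) :=
  (H.isWeight hh).measurable_gaussOp h hu

lemma IsField.exists_abs_variation_le {M : ℝ} {ξ : Space d → Space d} (H : IsField M ξ) {h : ℝ}
    (hh : 0 < h) {u : Space d → ℝ} (hu : u ∈ configSpace d) : ∃ B, ∀ x, |variation h ξ u x| ≤ B :=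
  ⟨_, fun x => (H.isWeight hh).abs_gaussOp_le hh (abs_le_one_of_mem hu) x⟩

/-- Transport commutes with u ↦ 1 − u, and averaging preserves constants, so the difference
quotients of u and 1 − u are opposite; the claim is the equality of their limits. -/
lemma IsField.variation_one_sub {M : ℝ} {ξ : Space d → Space d} (H : IsField M ξ) {h : ℝ}
    (hh : 0 < h) {u : Space d → ℝ} (hu : u ∈ configSpace d) (x : Space d) :
    variation h ξ (fun y => 1 - u y) x = -variation h ξ u x := by
  have hu' := one_sub_mem hu
  have h1 := H.tendsto_smoothing_transport hh hu'.1 (abs_le_one_of_mem hu') x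
  have h2 := (H.tendsto_smoothing_transport hh hu.1 (abs_le_one_of_mem hu) x).neg
  refine tendsto_nhds_unique h1 (h2.congr' ?_)
  filter_upwards [(eventually_small M).filter_mono nhdsWithin_le_nhds] with s hs
  have h3 : transport ξ s (fun y => 1 - u y) = fun y => 1 - transport ξ s u y := rfl
  rw [h3, smoothing_one_sub hh (H.transport_mem hs.2 hu), smoothing_one_sub hh hu]
  ring

lemma IsField.tendsto_configDist_div {M : ℝ} {ξ : Space d → Space d} (H : IsField M ξ) {h : ℝ}
    (hh : 0 < h) {u : Space d → ℝ} (hu : u ∈ configSpace d) :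
    Tendsto (fun s => configDist h (transport ξ s u) u / s) (𝓝[>] 0)
      (𝓝 (Real.sqrt (2 * Real.sqrt h * ∫ x in unitCube d, variation h ξ u x ^ 2))) := by
  obtain ⟨C, hC0, hC⟩ := H.exists_abs_smoothing_transport_sub_le hh
  have small : ∀ᶠ s : ℝ in 𝓝[>] 0, (|s| ≤ 1 ∧ |s| * M < 1) ∧ 0 < s :=
    ((eventually_small M).filter_mono nhdsWithin_le_nhds).and self_mem_nhdsWithin
  have h1 : Tendsto (fun s => ∫ x in unitCube d,
      ((smoothing h (transport ξ s u) x - smoothing h u x) / s) ^ 2) (𝓝[>] 0)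
      (𝓝 (∫ x in unitCube d, variation h ξ u x ^ 2)) := by
    refine tendsto_integral_filter_of_dominated_convergence (fun _ => C ^ 2) ?_ ?_
      (integrable_const _) ?_
    · filter_upwards [small] with s hs
      exact (((measurable_smoothing h (H.measurable_transport hs.1.2 hu.1)).sub
        (measurable_smoothing h hu.1)).div_const s |>.pow_const 2).aestronglyMeasurable
    · filter_upwards [small] with s hs
      refine ae_of_all _ fun x => ?_
      rw [norm_pow, norm_div, Real.norm_eq_abs, Real.norm_eq_abs]
      gcongr
      rw [div_le_iff₀ (abs_pos.2 hs.2.ne')]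
      exact hC s hs.1.1 hs.1.2 u hu.1 (abs_le_one_of_mem hu) x
    · exact ae_of_all _ fun x =>
        (H.tendsto_smoothing_transport hh hu.1 (abs_le_one_of_mem hu) x).pow 2
  refine ((Real.continuous_sqrt.tendsto _).comp (h1.const_mul (2 * Real.sqrt h))).congr' ?_
  filter_upwards [small] with s hs
  rw [Function.comp_apply, configDist_eq hh (H.transport_mem hs.1.2 hu) hu]
  simp only [div_pow]
  rw [integral_div, ← mul_div_assoc, Real.sqrt_div' _ (sq_nonneg s), Real.sqrt_sq hs.2.le]

lemma IsField.tendsto_energy_div {M : ℝ} {ξ : Space d → Space d} (H : IsField M ξ) {h : ℝ}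
    (hh : 0 < h) {u : Space d → ℝ} (hu : u ∈ configSpace d) :
    Tendsto (fun s => (energy h u - energy h (transport ξ s u)) / s) (𝓝[>] 0)
      (𝓝 (1 / Real.sqrt h *
        ∫ x in unitCube d, variation h ξ u x * (2 * smoothing h u x - 1))) := by
  obtain ⟨C, hC0, hC⟩ := H.exists_abs_smoothing_transport_sub_le hh
  obtain ⟨B, hB⟩ := exists_abs_smoothing_le (d := d) hh
  have small : ∀ᶠ s : ℝ in 𝓝[>] 0, (|s| ≤ 1 ∧ |s| * M < 1) ∧ 0 < s :=
    ((eventually_small M).filter_mono nhdsWithin_le_nhds).and self_mem_nhdsWithin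
  have hid : Tendsto (fun s : ℝ => s) (𝓝[>] 0) (𝓝 0) := tendsto_id.mono_left nhdsWithin_le_nhds
  have mu := measurable_smoothing h hu.1
  -- If the average A changes by δ, then (1 − A)A decreases by δ(2A − 1) + δ². With δ = s q,
  -- division by s leaves q(2A − 1) + q² s, whose second term disappears in the limit.
  have h1 : Tendsto (fun s => ∫ x in unitCube d,
      ((smoothing h (transport ξ s u) x - smoothing h u x) / s * (2 * smoothing h u x - 1)
        + ((smoothing h (transport ξ s u) x - smoothing h u x) / s) ^ 2 * s)) (𝓝[>] 0)
      (𝓝 (∫ x in unitCube d, variation h ξ u x * (2 * smoothing h u x - 1))) := by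
    refine tendsto_integral_filter_of_dominated_convergence
      (fun _ => C * (2 * B + 1) + C ^ 2 * 1) ?_ ?_ (integrable_const _) ?_
    · filter_upwards [small] with s hs
      have mv := measurable_smoothing h (H.measurable_transport hs.1.2 hu.1)
      exact Measurable.aestronglyMeasurable (by fun_prop)
    · filter_upwards [small] with s hs
      refine ae_of_all _ fun x => ?_
      have hq : |(smoothing h (transport ξ s u) x - smoothing h u x) / s| ≤ C := by
        rw [abs_div, div_le_iff₀ (abs_pos.2 hs.2.ne')]
        exact hC s hs.1.1 hs.1.2 u hu.1 (abs_le_one_of_mem hu) x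
      have h2 : |2 * smoothing h u x - 1| ≤ 2 * B + 1 := by
        have := hB u hu x
        rw [abs_le] at this ⊢
        constructor <;> linarith
      rw [Real.norm_eq_abs]
      refine (abs_add_le _ _).trans (add_le_add ?_ ?_)
      · rw [abs_mul]; gcongr
      · rw [abs_mul, abs_pow]; gcongr; exact hs.1.1
    · refine ae_of_all _ fun x => ?_
      have h3 := H.tendsto_smoothing_transport hh hu.1 (abs_le_one_of_mem hu) x
      simpa using (h3.mul_const (2 * smoothing h u x - 1)).add ((h3.pow 2).mul hid)
  refine (h1.const_mul (1 / Real.sqrt h)).congr' ?_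
  filter_upwards [small] with s hs
  have hv := H.transport_mem hs.1.2 hu
  have mv := measurable_smoothing h hv.1
  have ib : ∀ w ∈ configSpace d, IntegrableOn
      (fun x => (1 - smoothing h w x) * smoothing h w x) (unitCube d) := by
    intro w hw
    have mw := measurable_smoothing h hw.1
    refine integrableOn_unitCube_of_abs_le (by fun_prop) ((1 + B) * B) fun x => ?_
    have := hB w hw x
    have hB0 : 0 ≤ B := (abs_nonneg _).trans this
    rw [abs_mul]
    gcongr
    exact (abs_sub _ _).trans (by rw [abs_one]; linarith)
  rw [energy_eq hh hu, energy_eq hh hv, ← mul_sub, ← integral_sub (ib u hu) (ib _ hv), mul_div_assoc,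
    ← integral_div]
  congr 2; ext x
  have := hs.2.ne'
  field_simp
  ring

/-- The slope is bounded below by the first variation along a vector field. -/
lemma IsField.le_energySlope {M : ℝ} {ξ : Space d → Space d} (H : IsField M ξ) {h : ℝ}
    (hh : 0 < h) {u : Space d → ℝ} (hu : u ∈ configSpace d) :
    ENNReal.ofReal (1 / Real.sqrt h *
        (∫ x in unitCube d, variation h ξ u x * (2 * smoothing h u x - 1))
      - Real.sqrt h * ∫ x in unitCube d, variation h ξ u x ^ 2)
      ≤ 1 / 2 * energySlope h u ^ 2 := by
  set I := ∫ x in unitCube d, variation h ξ u x ^ 2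
  have hI : 0 ≤ I := integral_nonneg fun x => sq_nonneg _
  have hs : 0 < Real.sqrt h := Real.sqrt_pos.2 hh
  rcases hI.eq_or_lt with h0 | h0
  -- In the degenerate case D = 0 no quotient is available, but then the variation vanishes almost
  -- everywhere, so L = 0 as well and the claim is trivial.
  · obtain ⟨B, hB⟩ := H.exists_abs_variation_le hh hu
    have mW := H.measurable_variation hh hu.1
    have h1 : (fun x => variation h ξ u x ^ 2) =ᵐ[volume.restrict (unitCube d)] 0 := by
      refine (integral_eq_zero_iff_of_nonneg (fun x => sq_nonneg _) ?_).1 h0.symm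
      refine integrableOn_unitCube_of_abs_le (mW.pow_const 2) (B ^ 2) fun x => ?_
      rw [abs_pow]
      exact pow_le_pow_left₀ (abs_nonneg _) (hB x) 2
    have h2 : ∫ x in unitCube d, variation h ξ u x * (2 * smoothing h u x - 1) = 0 := by
      refine integral_eq_zero_of_ae ?_
      filter_upwards [h1] with x hx
      have : variation h ξ u x = 0 := by simpa using hx
      simp [this]
    rw [h2, ← h0]; simp
  · have hD : 0 < Real.sqrt (2 * Real.sqrt h * I) := Real.sqrt_pos.2 (by positivity)
    have h1 := le_metricSlope_of_curve (M := configSpace d) (dist := configDist h) (E := energy h)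
      (by
        filter_upwards [(eventually_small M).filter_mono nhdsWithin_le_nhds] with s hs
        exact H.transport_mem hs.2 hu)
      (H.tendsto_configDist_div hh hu) (H.tendsto_energy_div hh hu) hD
    refine le_trans (le_of_eq ?_) (ofReal_sub_le_half_sq hD h1)
    rw [Real.sq_sqrt (by positivity)]
    congr 2; ring

/-! ### The first variation as a correlation integral -/

lemma integrable_prod_heatKernel_mul {Y : Type*} [MeasurableSpace Y] {ρ : Measure Y}
    [IsFiniteMeasure ρ] {h : ℝ} (hh : 0 < h) {f : Y × Space d → ℝ}
    (hf : AEStronglyMeasurable f (ρ.prod volume)) (C : ℝ) (m : ℕ)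
    (hC : ∀ᵐ p ∂(ρ.prod volume), |f p| ≤ C * (1 + ‖p.2‖) ^ m) :
    Integrable (fun p : Y × Space d => heatKernel d h p.2 * f p) (ρ.prod volume) := by
  have i0 : Integrable (fun p : Y × Space d => C * ((1 + ‖p.2‖) ^ m * heatKernel d h p.2))
      (ρ.prod volume) := by
    simpa using (integrable_const C).mul_prod (integrable_pow_mul_heatKernel (d := d) hh m)
  refine i0.mono' ?_ ?_
  · exact ((continuous_heatKernel h).measurable.comp measurable_snd).aestronglyMeasurable.mul hf
  · filter_upwards [hC] with p hp
    rw [Real.norm_eq_abs, abs_mul, abs_of_nonneg (heatKernel_nonneg h _), ← mul_assoc, mul_comm]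
    exact mul_le_mul_of_nonneg_right hp (heatKernel_nonneg h _)

lemma IsWeight.mono {M M' : ℝ} {α : Space d → ℝ} {β : Space d → Space d} (H : IsWeight M α β)
    (hM : M ≤ M') : IsWeight M' α β :=
  ⟨H.meas_fst, H.meas_snd, H.per_fst, H.per_snd, fun x => (H.bound_fst x).trans hM,
    fun x => (H.bound_snd x).trans hM⟩

lemma integrable_correlation {M : ℝ} {α α' : Space d → ℝ} {β β' : Space d → Space d}
    (H : IsWeight M α β) (H' : IsWeight M α' β') {h : ℝ} (hh : 0 < h) {a b : Space d → ℝ}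
    (ham : Measurable a) (hbm : Measurable b) (ha : ∀ x, |a x| ≤ 1) (hb : ∀ x, |b x| ≤ 1) :
    Integrable (fun p : Space d × Space d => heatKernel d h p.2 * (a p.1 * b (p.1 - p.2) *
        ((α p.1 - inner ℝ (β p.1) p.2 / 2) * (α' (p.1 - p.2) + inner ℝ (β' (p.1 - p.2)) p.2 / 2)
          + h / 4 * inner ℝ (β p.1) (β' (p.1 - p.2)))))
      ((volume.restrict (unitCube d)).prod volume) := by
  have hM := H.nonneg
  have aff : ∀ (p : ℝ) (v w : Space d), |p| ≤ M → ‖v‖ ≤ M →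
      |p| + |inner ℝ v w / 2| ≤ M * (1 + ‖w‖) := by
    intro p v w hp hv
    have h1 : |inner ℝ v w| ≤ M * ‖w‖ := (abs_real_inner_le_norm v w).trans (by gcongr)
    rw [abs_div, abs_two]
    linarith [abs_nonneg (inner ℝ v w)]
  refine integrable_prod_heatKernel_mul hh ?_ (M * M + h / 4 * (M * M)) 2 (ae_of_all _ fun p => ?_)
  · have := H.meas_fst; have := H.meas_snd; have := H'.meas_fst; have := H'.meas_snd
    exact Measurable.aestronglyMeasurable (by fun_prop)
  · set y := p.1
    set z := p.2
    have h1 : |α y - inner ℝ (β y) z / 2| ≤ M * (1 + ‖z‖) :=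
      (abs_sub _ _).trans (aff _ _ _ (H.bound_fst _) (H.bound_snd _))
    have h2 : |α' (y - z) + inner ℝ (β' (y - z)) z / 2| ≤ M * (1 + ‖z‖) :=
      (abs_add_le _ _).trans (aff _ _ _ (H'.bound_fst _) (H'.bound_snd _))
    have h3 : |inner ℝ (β y) (β' (y - z))| ≤ M * M := (abs_real_inner_le_norm _ _).trans
      (mul_le_mul (H.bound_snd _) (H'.bound_snd _) (norm_nonneg _) hM)
    have h4 : |a y * b (y - z)| ≤ 1 := by
      rw [abs_mul]; exact mul_le_one₀ (ha _) (abs_nonneg _) (hb _)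
    have h5 : (1 : ℝ) ≤ (1 + ‖z‖) ^ 2 := one_le_pow₀ (by simp)
    rw [abs_mul]
    refine (mul_le_of_le_one_left (abs_nonneg _) h4).trans ((abs_add_le _ _).trans ?_)
    rw [abs_mul, abs_mul, abs_of_pos (by positivity : 0 < h / 4)]
    calc _ ≤ (M * (1 + ‖z‖)) * (M * (1 + ‖z‖)) + h / 4 * (M * M) := by gcongr
      _ = M * M * (1 + ‖z‖) ^ 2 + h / 4 * (M * M) * 1 := by ring
      _ ≤ M * M * (1 + ‖z‖) ^ 2 + h / 4 * (M * M) * (1 + ‖z‖) ^ 2 := by gcongr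
      _ = _ := by ring

lemma integral_heatKernel_mul_eq {h : ℝ} (hh : 0 < h) (f : Space d → ℝ) :
    ∫ z, heatKernel d h z * f z = ∫ z, heatKernel d 1 z * f (Real.sqrt h • z) := by
  have hs : 0 < Real.sqrt h := Real.sqrt_pos.2 hh
  have h1 := Measure.integral_comp_smul (volume : Measure (Space d))
    (fun z => heatKernel d h z * f z) (Real.sqrt h)
  rw [finrank_euclideanSpace_fin, abs_of_pos (by positivity), smul_eq_mul] at h1
  have h2 : ∀ z : Space d, heatKernel d h (Real.sqrt h • z)
      = (Real.sqrt h ^ d)⁻¹ * heatKernel d 1 z := by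
    intro z
    unfold heatKernel
    rw [norm_smul, mul_pow, Real.norm_eq_abs, sq_abs, Real.sq_sqrt hh.le,
      Real.sqrt_mul (by positivity), mul_one, mul_pow]
    have : -(h * ‖z‖ ^ 2) / (2 * h) = -‖z‖ ^ 2 / (2 * 1) := by field_simp
    rw [this]
    field_simp
  simp_rw [h2, mul_assoc] at h1
  rw [integral_const_mul] at h1
  have h3 : (Real.sqrt h ^ d)⁻¹ ≠ 0 := by positivity
  exact (mul_left_cancel₀ h3 h1).symm

lemma linear_combination_integral_prod {Y Z : Type*} [MeasurableSpace Y] [MeasurableSpace Z]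
    {ρ : Measure Y} {σ : Measure Z} [SFinite ρ] [SFinite σ] {f g k : Y × Z → ℝ}
    (hf : Integrable f (ρ.prod σ)) (hg : Integrable g (ρ.prod σ)) (hk : Integrable k (ρ.prod σ))
    (a b c : ℝ) :
    a * ∫ p, f p ∂(ρ.prod σ) + b * ∫ p, g p ∂(ρ.prod σ) + c * ∫ p, k p ∂(ρ.prod σ)
      = ∫ y, ∫ z, (a * f (y, z) + b * g (y, z) + c * k (y, z)) ∂σ ∂ρ := by
  have h1 := ((hf.const_mul a).add (hg.const_mul b)).add (hk.const_mul c)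
  have h2 := integral_prod _ h1
  simp only [Pi.add_apply] at h2
  rw [← h2, integral_add (by exact (hf.const_mul a).add (hg.const_mul b)) (hk.const_mul c),
    integral_add (hf.const_mul a) (hg.const_mul b), integral_const_mul, integral_const_mul,
    integral_const_mul]

/-- The test function of `(z, y)` whose correlation integral is the first variation minus the
quadratic term. -/
def correlationTest (h : ℝ) (ξ : Space d → Space d) (z y : Space d) : ℝ :=
  -(coordTrace (fderiv ℝ ξ y) + coordTrace (fderiv ℝ ξ (y - Real.sqrt h • z)))
    + inner ℝ (ξ y - ξ (y - Real.sqrt h • z)) z / Real.sqrt h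
    + (Real.sqrt h * coordTrace (fderiv ℝ ξ y) - inner ℝ (ξ y) z)
      * (Real.sqrt h * coordTrace (fderiv ℝ ξ (y - Real.sqrt h • z))
        + inner ℝ (ξ (y - Real.sqrt h • z)) z)
    + inner ℝ (ξ y) (ξ (y - Real.sqrt h • z))

/-- The expression L − D²/2 becomes a single integral against the prelimit measure of the
convergence hypothesis, so that the factor h^{-1/2} is carried by that measure and the test function
stays bounded as h → 0 for fixed z. -/
lemma IsField.variation_eq_correlation {M : ℝ} {ξ : Space d → Space d} (H : IsField M ξ) {h : ℝ}
    (hh : 0 < h) {u : Space d → ℝ} (hu : u ∈ configSpace d) :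
    1 / Real.sqrt h * (∫ x in unitCube d, variation h ξ u x * (2 * smoothing h u x - 1))
      - Real.sqrt h * ∫ x in unitCube d, variation h ξ u x ^ 2
      = ∫ y in unitCube d, ∫ z, correlationTest h ξ z y * (heatKernel d 1 z *
          (1 / Real.sqrt h * (u y * (1 - u (y - Real.sqrt h • z))))) := by
  have hs : 0 < Real.sqrt h := Real.sqrt_pos.2 hh
  have hu' := one_sub_mem hu
  have b1 := abs_le_one_of_mem hu
  have b2 := abs_le_one_of_mem hu'
  have mA := measurable_smoothing h hu.1
  have mW := H.measurable_variation hh hu.1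
  obtain ⟨B, hB⟩ := exists_abs_smoothing_le (d := d) hh
  obtain ⟨B', hB'⟩ := H.exists_abs_variation_le hh hu
  -- The pairing formula takes one bound for both weights, hence the maximum of the two.
  set N := max 1 (d * M + 2 / h * M)
  have w1 : IsWeight (d := d) N (fun _ => 1) (fun _ => 0) := isWeight_one.mono (le_max_left _ _)
  have w2 := (H.isWeight hh).mono (le_max_right 1 _)
  have E1 := setIntegral_gaussOp_mul_gaussOp w1 w2 hh hu.1 hu'.1 b1 b2 hu.2.1 hu'.2.1
  have E2 := setIntegral_gaussOp_mul_gaussOp w2 w1 hh hu.1 hu'.1 b1 b2 hu.2.1 hu'.2.1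
  have E3 := setIntegral_gaussOp_mul_gaussOp w2 w2 hh hu.1 hu'.1 b1 b2 hu.2.1 hu'.2.1
  have I1 := integrable_correlation w1 w2 hh hu.1 hu'.1 b1 b2
  have I2 := integrable_correlation w2 w1 hh hu.1 hu'.1 b1 b2
  have I3 := integrable_correlation w2 w2 hh hu.1 hu'.1 b1 b2
  rw [← integral_prod _ I1] at E1
  rw [← integral_prod _ I2] at E2
  rw [← integral_prod _ I3] at E3
  -- Write A and W for the average and variation of u; those of 1 − u are 1 − A and −W. Then W(2A −
  -- 1) = −A(−W) − W(1 − A), and W² = −W(−W), so each product pairs u with 1 − u.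
  have F1 : ∫ x in unitCube d, variation h ξ u x * (2 * smoothing h u x - 1)
      = -(∫ x in unitCube d, smoothing h u x * variation h ξ (fun y => 1 - u y) x)
        - ∫ x in unitCube d, variation h ξ u x * smoothing h (fun y => 1 - u y) x := by
    simp only [H.variation_one_sub hh hu, smoothing_one_sub hh hu]
    rw [← integral_neg, ← integral_sub]
    · congr 1; ext x; ring
    · refine integrableOn_unitCube_of_abs_le (by fun_prop) (B * B') fun x => ?_
      rw [abs_neg, abs_mul, abs_neg]
      exact mul_le_mul (hB u hu x) (hB' x) (abs_nonneg _) ((abs_nonneg _).trans (hB u hu x))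
    · refine integrableOn_unitCube_of_abs_le (by fun_prop) (B' * B) fun x => ?_
      rw [abs_mul, ← smoothing_one_sub hh hu]
      exact mul_le_mul (hB' x) (hB _ hu' x) (abs_nonneg _) ((abs_nonneg _).trans (hB' x))
  have F2 : ∫ x in unitCube d, variation h ξ u x ^ 2
      = -∫ x in unitCube d, variation h ξ u x * variation h ξ (fun y => 1 - u y) x := by
    simp only [H.variation_one_sub hh hu]
    rw [← integral_neg]
    congr 1; ext x; ring
  rw [F1, F2]
  unfold smoothing variation
  rw [E1, E2, E3]
  have sq : Real.sqrt h * Real.sqrt h = h := Real.mul_self_sqrt hh.le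
  -- In `alg` and `alg'` the letter s stands for √h, with h written s·s. The first combines the
  -- three pairings into one integrand; the second cancels the powers of s after z has been
  -- rescaled.
  have alg : ∀ s G U a b p q r : ℝ, 0 < s →
      -(1 / s) * (G * (U * ((1 - 0 / 2) * (b + 2 / (s * s) * q / 2) + s * s / 4 * 0)))
      + -(1 / s) * (G * (U * ((a - 2 / (s * s) * p / 2) * (1 + 0 / 2) + s * s / 4 * 0)))
      + s * (G * (U * ((a - 2 / (s * s) * p / 2) * (b + 2 / (s * s) * q / 2)
        + s * s / 4 * (2 / (s * s) * (2 / (s * s) * r)))))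
      = G * (1 / s * U * (-(a + b) + (p - q) / (s * s)
          + s * s * ((a - p / (s * s)) * (b + q / (s * s))) + r)) := by
    intro s G U a b p q r hs
    field_simp
    ring
  have alg' : ∀ s G U a b p q r : ℝ, 0 < s →
      G * (1 / s * U * (-(a + b) + (s * p - s * q) / (s * s)
          + s * s * ((a - s * p / (s * s)) * (b + s * q / (s * s))) + r))
      = (-(a + b) + (p - q) / s + (s * a - p) * (s * b + q) + r) * (G * (1 / s * U)) := by
    intro s G U a b p q r hs
    field_simp
  have lin := linear_combination_integral_prod I1 I2 I3 (-(1 / Real.sqrt h)) (-(1 / Real.sqrt h))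
    (Real.sqrt h)
  refine Eq.trans (by ring) (lin.trans ?_)
  calc _ = ∫ y in unitCube d, ∫ z, heatKernel d h z * (1 / Real.sqrt h * (u y * (1 - u (y - z))) *
        (-(coordTrace (fderiv ℝ ξ y) + coordTrace (fderiv ℝ ξ (y - z)))
          + (inner ℝ (ξ y) z - inner ℝ (ξ (y - z)) z) / h
          + h * ((coordTrace (fderiv ℝ ξ y) - inner ℝ (ξ y) z / h)
            * (coordTrace (fderiv ℝ ξ (y - z)) + inner ℝ (ξ (y - z)) z / h))
          + inner ℝ (ξ y) (ξ (y - z)))) := by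
        congr 1; ext y; congr 1; ext z
        simp only [inner_zero_left, inner_zero_right, real_inner_smul_left, real_inner_smul_right]
        have := alg (Real.sqrt h) (heatKernel d h z) (u y * (1 - u (y - z)))
          (coordTrace (fderiv ℝ ξ y)) (coordTrace (fderiv ℝ ξ (y - z))) (inner ℝ (ξ y) z)
          (inner ℝ (ξ (y - z)) z) (inner ℝ (ξ y) (ξ (y - z))) hs
        rw [sq] at this
        exact this
    _ = _ := by
        congr 1; ext y
        rw [integral_heatKernel_mul_eq hh]
        congr 1; ext z
        simp only [correlationTest, real_inner_smul_right, inner_sub_left]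
        have := alg' (Real.sqrt h) (heatKernel d 1 z) (u y * (1 - u (y - Real.sqrt h • z)))
          (coordTrace (fderiv ℝ ξ y)) (coordTrace (fderiv ℝ ξ (y - Real.sqrt h • z)))
          (inner ℝ (ξ y) z) (inner ℝ (ξ (y - Real.sqrt h • z)) z)
          (inner ℝ (ξ y) (ξ (y - Real.sqrt h • z))) hs
        rw [sq] at this
        exact this

/-! ### Test fields -/

/-- Periodicity reduces x to the cell via `ZSpan.fract`, and then compactness of the time interval
times a ball applies. -/
lemma exists_norm_le_of_periodic {V : Type*} [NormedAddCommGroup V] {F : ℝ × Space d → V}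
    (hF : Continuous F) (hp : ∀ t, TorusPeriodic (fun x => F (t, x))) {a b : ℝ}
    (hs : ∀ t, t ∉ Icc a b → ∀ x, F (t, x) = 0) : ∃ M, ∀ p, ‖F p‖ ≤ M := by
  obtain ⟨R, hR⟩ := (isBounded_unitCube (d := d)).subset_closedBall 0
  obtain ⟨M, hM⟩ := (isCompact_Icc.prod (isCompact_closedBall (0 : Space d) R)).exists_bound_of_continuousOn
    (f := F) (s := Icc a b ×ˢ Metric.closedBall 0 R) hF.continuousOn
  refine ⟨max M 0, fun ⟨t, x⟩ => ?_⟩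
  by_cases ht : t ∈ Icc a b
  · set B := (EuclideanSpace.basisFun (Fin d) ℝ).toBasis
    have h1 : ZSpan.fract B x ∈ unitCube d := by
      rw [unitCube_eq_fundamentalDomain]; exact ZSpan.fract_mem_fundamentalDomain B x
    have h2 : F (t, x) = F (t, ZSpan.fract B x) := by
      have := (hp t).add_mem_span (ZSpan.floor B x).2 (ZSpan.fract B x)
      rw [← this]
      congr 2
      simp [ZSpan.fract]
    rw [h2]
    exact (hM _ ⟨ht, hR h1⟩).trans (le_max_left _ _)
  · rw [hs t ht x]; simp

lemma IsTestField.contDiff_fderiv {T : ℝ} {ξ : ℝ → Space d → Space d} (H : IsTestField T ξ) :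
    ContDiff ℝ ∞ (fun p : ℝ × Space d => fderiv ℝ (ξ p.1) p.2) := by
  refine ContDiff.fderiv (f := fun p : ℝ × Space d => ξ p.1) (n := ∞) (m := ∞) ?_ contDiff_snd
    (by simp)
  exact H.smooth.comp ((contDiff_fst.comp contDiff_fst).prodMk contDiff_snd)

lemma IsTestField.contDiff_section {T : ℝ} {ξ : ℝ → Space d → Space d} (H : IsTestField T ξ)
    (t : ℝ) : ContDiff ℝ ∞ (ξ t) := H.smooth.comp (contDiff_const.prodMk contDiff_id)

/-- The constant is uniform in time. The second derivative enters only as a Lipschitz constant of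
∇ξ, which controls the Taylor remainder. -/
lemma IsTestField.exists_bound {T : ℝ} {ξ : ℝ → Space d → Space d} (H : IsTestField T ξ) :
    ∃ M, 0 ≤ M ∧ ∀ t, IsField M (ξ t) ∧
      ∀ x y, ‖fderiv ℝ (ξ t) x - fderiv ℝ (ξ t) y‖ ≤ M * ‖x - y‖ := by
  obtain ⟨a, b, -, -, hab⟩ := H.support
  have z0 : ∀ t, t ∉ Icc a b → ξ t = 0 := fun t ht => funext (hab t ht)
  have z1 : ∀ t, t ∉ Icc a b → fderiv ℝ (ξ t) = 0 := fun t ht => by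
    rw [z0 t ht]; ext1 x; exact fderiv_const_apply 0
  have c2 : Continuous (fun p : ℝ × Space d => fderiv ℝ (fderiv ℝ (ξ p.1)) p.2) := by
    refine (ContDiff.fderiv (f := fun p : ℝ × Space d => fderiv ℝ (ξ p.1)) (n := ∞) (m := ∞) ?_
      contDiff_snd (by simp)).continuous
    exact H.contDiff_fderiv.comp ((contDiff_fst.comp contDiff_fst).prodMk contDiff_snd)
  obtain ⟨M0, h0⟩ := exists_norm_le_of_periodic H.smooth.continuous H.periodic hab
  obtain ⟨M1, h1⟩ := exists_norm_le_of_periodic H.contDiff_fderiv.continuous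
    (fun t => (H.periodic t).fderiv) (a := a) (b := b) (fun t ht x => by simp only [z1 t ht, Pi.zero_apply])
  obtain ⟨M2, h2⟩ := exists_norm_le_of_periodic (V := Space d →L[ℝ] Space d →L[ℝ] Space d)
    (F := fun p : ℝ × Space d => fderiv ℝ (fderiv ℝ (ξ p.1)) p.2) c2
    (fun t i x => by
      have h3 : fderiv ℝ (ξ t) = fun y => fderiv ℝ (ξ t) (y + EuclideanSpace.single i 1) :=
        funext fun y => ((H.periodic t).fderiv i y).symm
      change fderiv ℝ (fderiv ℝ (ξ t)) (x + _) = fderiv ℝ (fderiv ℝ (ξ t)) x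
      conv_rhs => rw [h3]
      rw [fderiv_comp_add_right])
    (a := a) (b := b) (fun t ht x => by
      simp only [z1 t ht]; exact fderiv_const_apply 0)
  have le0 : M0 ≤ max M0 (max M1 M2) := le_max_left _ _
  have le1 : M1 ≤ max M0 (max M1 M2) := (le_max_left _ _).trans (le_max_right _ _)
  have le2 : M2 ≤ max M0 (max M1 M2) := (le_max_right _ _).trans (le_max_right _ _)
  refine ⟨max M0 (max M1 M2), (norm_nonneg _).trans ((h0 0).trans le0), fun t => ⟨?_, ?_⟩⟩
  · exact ⟨(H.contDiff_section t).of_le (by norm_cast), H.periodic t,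
      fun x => (h0 (t, x)).trans le0, fun x => (h1 (t, x)).trans le1⟩
  · intro x y
    refine Convex.norm_image_sub_le_of_norm_fderiv_le (𝕜 := ℝ) (s := univ) (fun z _ => ?_)
      (fun z _ => (h2 (t, z)).trans le2) convex_univ (mem_univ y) (mem_univ x)
    have : ContDiff ℝ ∞ (fderiv ℝ (ξ t)) :=
      H.contDiff_fderiv.comp (contDiff_const.prodMk contDiff_id)
    exact this.differentiable (by simp) z

/-! ### The limiting test function -/

lemma coordTrace_sub (A B : Space d →L[ℝ] Space d) :
    coordTrace (A - B) = coordTrace A - coordTrace B := by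
  simp [coordTrace, Finset.sum_sub_distrib]

lemma continuous_coordTrace : Continuous (coordTrace (d := d)) := by
  unfold coordTrace
  exact continuous_finsetSum _ fun i _ => (EuclideanSpace.proj (𝕜 := ℝ) i).continuous.comp
    (ContinuousLinearMap.apply ℝ (Space d) (EuclideanSpace.single i (1 : ℝ))).continuous

/-- The limit of `correlationTest h ξ z y` as `h → 0`. -/
def limitTest (ξ : Space d → Space d) (z y : Space d) : ℝ :=
  -2 * coordTrace (fderiv ℝ ξ y) + inner ℝ (fderiv ℝ ξ y z) z - inner ℝ (ξ y) z ^ 2 + ‖ξ y‖ ^ 2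

/-- Replacing y − √h z by y costs √h |z| in each term. The difference quotient of ξ needs Taylor
expansion with a Lipschitz ∇ξ; its remainder, and the product of the two factors ξ·z, are
responsible for the cubic growth. -/
lemma abs_correlationTest_sub_limitTest_le {M : ℝ} {ξ : Space d → Space d} (H : IsField M ξ)
    (hl : ∀ x y, ‖fderiv ℝ ξ x - fderiv ℝ ξ y‖ ≤ M * ‖x - y‖) {h : ℝ} (hh : 0 < h) (h1 : h ≤ 1)
    (z y : Space d) :
    |correlationTest h ξ z y - limitTest ξ z y|
      ≤ (d * M + M + (d * M * (d * M + M) + M * (d * M) + M * M) + M * M)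
        * Real.sqrt h * (1 + ‖z‖) ^ 3 := by
  have hM := H.nonneg
  set s := Real.sqrt h
  have hs : 0 < s := Real.sqrt_pos.2 hh
  have hs1 : s ≤ 1 := Real.sqrt_le_one.2 h1
  set r := ‖z‖
  have hr : 0 ≤ r := norm_nonneg z
  set y' := y - s • z
  have hyy : ‖y - y'‖ = s * r := by
    simp only [y', sub_sub_cancel, norm_smul, Real.norm_of_nonneg hs.le, r]
  set a := coordTrace (fderiv ℝ ξ y)
  set b := coordTrace (fderiv ℝ ξ y')
  have hN : (0 : ℝ) ≤ d * M := by positivity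
  have ha : |a| ≤ d * M := (abs_coordTrace_le _).trans (by gcongr; exact H.bound_fderiv y)
  have hb : |b| ≤ d * M := (abs_coordTrace_le _).trans (by gcongr; exact H.bound_fderiv y')
  have hab : |a - b| ≤ d * M * (s * r) := by
    rw [← coordTrace_sub, ← hyy, mul_assoc]
    exact (abs_coordTrace_le _).trans (by gcongr; exact hl y y')
  have hξ : ‖ξ y - ξ y'‖ ≤ M * (s * r) := by
    rw [← hyy]
    exact Convex.norm_image_sub_le_of_norm_fderiv_le (𝕜 := ℝ) (fun z _ => H.differentiable z)
      (fun z _ => H.bound_fderiv z) convex_univ (mem_univ y') (mem_univ y)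
  have hp : |inner ℝ (ξ y) z| ≤ M * r :=
    (abs_real_inner_le_norm _ _).trans (by gcongr; exact H.bound y)
  have hq : |inner ℝ (ξ y') z| ≤ M * r :=
    (abs_real_inner_le_norm _ _).trans (by gcongr; exact H.bound y')
  have hpq : |inner ℝ (ξ y) z - inner ℝ (ξ y') z| ≤ M * (s * r) * r := by
    rw [← inner_sub_left]
    exact (abs_real_inner_le_norm _ _).trans (by gcongr)
  have hD : |inner ℝ (ξ y - ξ y') z / s - inner ℝ (fderiv ℝ ξ y z) z| ≤ M * (s * r) * r * r := by
    have h2 : ‖ξ y - ξ y' - fderiv ℝ ξ y (y - y')‖ ≤ M * (s * r) * ‖y - y'‖ := by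
      refine Convex.norm_image_sub_le_of_norm_fderiv_le' (𝕜 := ℝ)
        (s := Metric.closedBall y (s * r))
        (fun z _ => H.differentiable z) (fun w hw => ?_) (convex_closedBall _ _) ?_ ?_
      · exact (hl w y).trans (by gcongr; exact mem_closedBall_iff_norm.1 hw)
      · rw [mem_closedBall_iff_norm, norm_sub_rev, hyy]
      · exact Metric.mem_closedBall_self (by positivity)
    have h3 : fderiv ℝ ξ y (y - y') = s • fderiv ℝ ξ y z := by simp [y']
    have h4 : inner ℝ (ξ y - ξ y') z / s - inner ℝ (fderiv ℝ ξ y z) z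
        = inner ℝ (ξ y - ξ y' - fderiv ℝ ξ y (y - y')) z / s := by
      rw [inner_sub_left (ξ y - ξ y'), h3, real_inner_smul_left]; field_simp
    rw [h4, abs_div, abs_of_pos hs, div_le_iff₀ hs]
    refine (abs_real_inner_le_norm _ _).trans ?_
    rw [hyy] at h2
    calc _ ≤ M * (s * r) * (s * r) * r := by gcongr
      _ = _ := by ring
  have hE : |inner ℝ (ξ y) (ξ y') - ‖ξ y‖ ^ 2| ≤ M * (M * (s * r)) := by
    rw [← real_inner_self_eq_norm_sq, ← inner_sub_right]
    refine (abs_real_inner_le_norm _ _).trans ?_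
    rw [norm_sub_rev]
    exact mul_le_mul (H.bound y) hξ (norm_nonneg _) hM
  have hF : |(s * a - inner ℝ (ξ y) z) * (s * b + inner ℝ (ξ y') z) + inner ℝ (ξ y) z ^ 2|
      ≤ s * (d * M) * (d * M + M * r) + M * r * (s * (d * M)) + M * r * (M * (s * r) * r) := by
    have e : (s * a - inner ℝ (ξ y) z) * (s * b + inner ℝ (ξ y') z) + inner ℝ (ξ y) z ^ 2
        = s * a * (s * b + inner ℝ (ξ y') z) - inner ℝ (ξ y) z * (s * b)
          + inner ℝ (ξ y) z * (inner ℝ (ξ y) z - inner ℝ (ξ y') z) := by ring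
    have hsa : |s * a| ≤ s * (d * M) := by rw [abs_mul, abs_of_pos hs]; gcongr
    have hsb : |s * b| ≤ s * (d * M) := by rw [abs_mul, abs_of_pos hs]; gcongr
    have hsbq : |s * b + inner ℝ (ξ y') z| ≤ d * M + M * r :=
      (abs_add_le _ _).trans (add_le_add (hsb.trans (mul_le_of_le_one_left hN hs1)) hq)
    rw [e]
    refine (abs_add_le _ _).trans (add_le_add ((abs_sub _ _).trans (add_le_add ?_ ?_)) ?_)
    · rw [abs_mul]; gcongr
    · rw [abs_mul]; gcongr
    · rw [abs_mul]; gcongr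
  have e : correlationTest h ξ z y - limitTest ξ z y = (a - b)
      + (inner ℝ (ξ y - ξ y') z / s - inner ℝ (fderiv ℝ ξ y z) z)
      + ((s * a - inner ℝ (ξ y) z) * (s * b + inner ℝ (ξ y') z) + inner ℝ (ξ y) z ^ 2)
      + (inner ℝ (ξ y) (ξ y') - ‖ξ y‖ ^ 2) := by
    simp only [correlationTest, limitTest, a, b, y', s]; ring
  have p1 : r ≤ (1 + r) ^ 3 := by nlinarith [pow_nonneg hr 2, pow_nonneg hr 3]
  have p0 : 1 ≤ (1 + r) ^ 3 := one_le_pow₀ (by linarith)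
  have p3 : r ^ 3 ≤ (1 + r) ^ 3 := by gcongr; linarith
  rw [e]
  calc _ ≤ d * M * (s * r) + M * (s * r) * r * r
        + (s * (d * M) * (d * M + M * r) + M * r * (s * (d * M)) + M * r * (M * (s * r) * r))
        + M * (M * (s * r)) :=
        (abs_add_le _ _).trans (add_le_add ((abs_add_le _ _).trans
          (add_le_add ((abs_add_le _ _).trans (add_le_add hab hD)) hF)) hE)
    _ = (d * M * r + M * r ^ 3 + (d * M * (d * M * 1 + M * r) + M * (d * M) * r + M * M * r ^ 3)
        + M * M * r) * s := by ring
    _ ≤ (d * M * (1 + r) ^ 3 + M * (1 + r) ^ 3 + (d * M * (d * M * (1 + r) ^ 3 + M * (1 + r) ^ 3)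
        + M * (d * M) * (1 + r) ^ 3 + M * M * (1 + r) ^ 3) + M * M * (1 + r) ^ 3) * s := by gcongr
    _ = _ := by ring

lemma abs_limitTest_le {M : ℝ} {ξ : Space d → Space d} (H : IsField M ξ) (z y : Space d) :
    |limitTest ξ z y| ≤ (2 * (d * M) + M + M ^ 2 + M ^ 2) * (1 + ‖z‖) ^ 2 := by
  have hM := H.nonneg
  have ha : |-2 * coordTrace (fderiv ℝ ξ y)| ≤ 2 * (d * M) := by
    rw [abs_mul, abs_neg, abs_two]
    gcongr
    exact (abs_coordTrace_le _).trans (by gcongr; exact H.bound_fderiv y)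
  have hb : |inner ℝ (fderiv ℝ ξ y z) z| ≤ M * ‖z‖ * ‖z‖ := by
    refine (abs_real_inner_le_norm _ _).trans ?_
    gcongr
    exact ((fderiv ℝ ξ y).le_opNorm z).trans (by gcongr; exact H.bound_fderiv y)
  have hc : |inner ℝ (ξ y) z ^ 2| ≤ (M * ‖z‖) ^ 2 := by
    rw [abs_pow]
    gcongr
    exact (abs_real_inner_le_norm _ _).trans (by gcongr; exact H.bound y)
  have hd : |‖ξ y‖ ^ 2| ≤ M ^ 2 := by
    rw [abs_of_nonneg (by positivity)]; gcongr; exact H.bound y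
  have p0 : 1 ≤ (1 + ‖z‖) ^ 2 := one_le_pow₀ (by simp)
  have p2 : ‖z‖ ^ 2 ≤ (1 + ‖z‖) ^ 2 := by gcongr; simp
  calc _ ≤ 2 * (d * M) + M * ‖z‖ * ‖z‖ + (M * ‖z‖) ^ 2 + M ^ 2 :=
        (abs_add_le _ _).trans (add_le_add ((abs_sub _ _).trans
          (add_le_add ((abs_add_le _ _).trans (add_le_add ha hb)) hc)) hd)
    _ = 2 * (d * M) * 1 + M * ‖z‖ ^ 2 + M ^ 2 * ‖z‖ ^ 2 + M ^ 2 * 1 := by ring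
    _ ≤ 2 * (d * M) * (1 + ‖z‖) ^ 2 + M * (1 + ‖z‖) ^ 2 + M ^ 2 * (1 + ‖z‖) ^ 2
        + M ^ 2 * (1 + ‖z‖) ^ 2 := by gcongr
    _ = _ := by ring

/-- Integration of the limiting test function against `G_1(z) (ν·z)_+`. -/
lemma integral_limitTest (ξ : Space d → Space d) {ν : Space d} (hν : ‖ν‖ = 1) (y : Space d) :
    ∫ z, limitTest ξ z y * (heatKernel d 1 z * max (inner ℝ ν z) 0)
      = c₀ * (-(coordTrace (fderiv ℝ ξ y) - inner ℝ ν (fderiv ℝ ξ y ν)) - inner ℝ ν (ξ y) ^ 2) := by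
  set A := fderiv ℝ ξ y
  have hsum : ∀ v w : Space d, (inner ℝ v w : ℝ) = ∑ i, inner ℝ (EuclideanSpace.single i (1 : ℝ)) v
      * inner ℝ (EuclideanSpace.single i (1 : ℝ)) w := by
    intro v w
    simp [PiLp.inner_apply, mul_comm]
  -- This writes the quadratic form Az·z as a sum of products of linear forms, to which the
  -- half-space moment formula applies.
  have hA : ∀ v w : Space d, (inner ℝ (A v) w : ℝ)
      = ∑ i, inner ℝ (EuclideanSpace.single i (1 : ℝ)) v
        * inner ℝ (A (EuclideanSpace.single i (1 : ℝ))) w := by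
    intro v w
    have h1 := hsum v ((ContinuousLinearMap.adjoint A) w)
    simpa only [ContinuousLinearMap.adjoint_inner_right] using h1
  have i1 : ∀ a b : Space d, Integrable fun z : Space d =>
      heatKernel d 1 z * (max (inner ℝ ν z) 0 * (inner ℝ a z * inner ℝ b z)) := by
    intro a b
    refine integrable_mul_heatKernel one_pos (Continuous.aestronglyMeasurable (by fun_prop))
      (‖ν‖ * (‖a‖ * ‖b‖)) 3 fun z => ?_
    rw [abs_mul, abs_mul]
    have hmax : |max (inner ℝ ν z) 0| ≤ ‖ν‖ * (1 + ‖z‖) := by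
      rw [abs_of_nonneg (le_max_right _ _)]
      exact max_le ((le_abs_self _).trans (abs_inner_le_one_add ν z)) (by positivity)
    calc _ ≤ (‖ν‖ * (1 + ‖z‖)) * ((‖a‖ * (1 + ‖z‖)) * (‖b‖ * (1 + ‖z‖))) := by
          gcongr
          exacts [abs_inner_le_one_add a z, abs_inner_le_one_add b z]
      _ = _ := by ring
  have i0 : Integrable fun z : Space d => heatKernel d 1 z * max (inner ℝ ν z) 0 := by
    refine integrable_mul_heatKernel one_pos (Continuous.aestronglyMeasurable (by fun_prop))
      ‖ν‖ 1 fun z => ?_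
    rw [abs_of_nonneg (le_max_right _ _), pow_one]
    exact max_le ((le_abs_self _).trans (abs_inner_le_one_add ν z)) (by positivity)
  have e : ∀ z, limitTest ξ z y * (heatKernel d 1 z * max (inner ℝ ν z) 0)
      = (-2 * coordTrace A + ‖ξ y‖ ^ 2) * (heatKernel d 1 z * max (inner ℝ ν z) 0)
        + (∑ i, heatKernel d 1 z * (max (inner ℝ ν z) 0
            * (inner ℝ (EuclideanSpace.single i (1 : ℝ)) z
              * inner ℝ (A (EuclideanSpace.single i (1 : ℝ))) z)))
        - heatKernel d 1 z * (max (inner ℝ ν z) 0 * (inner ℝ (ξ y) z * inner ℝ (ξ y) z)) := by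
    intro z
    rw [← Finset.mul_sum, ← Finset.mul_sum, ← hA, limitTest]
    ring
  simp_rw [e]
  rw [integral_sub (by exact (i0.const_mul _).add (integrable_finsetSum _ fun i _ => i1 _ _))
      (i1 _ _), integral_add (i0.const_mul _) (integrable_finsetSum _ fun i _ => i1 _ _),
    integral_const_mul, integral_finsetSum _ fun i _ => i1 _ _]
  simp_rw [integral_heatKernel_max_inner_inner hν]
  rw [integral_heatKernel_max_inner hν, ← Finset.mul_sum, Finset.sum_add_distrib]
  have t1 : ∑ i : Fin d, inner ℝ (EuclideanSpace.single i (1 : ℝ))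
      (A (EuclideanSpace.single i (1 : ℝ))) = coordTrace A := by
    simp [coordTrace, EuclideanSpace.inner_single_left]
  have t2 : ∑ i : Fin d, inner ℝ ν (EuclideanSpace.single i (1 : ℝ))
      * inner ℝ ν (A (EuclideanSpace.single i (1 : ℝ))) = inner ℝ ν (A ν) := by
    rw [real_inner_comm, hA]
    refine Finset.sum_congr rfl fun i _ => ?_
    rw [real_inner_comm, real_inner_comm ν (A _)]
  -- The quadratic form contributes ∇·ξ + ν·∇ξ ν, so one of the two divergences survives; |ξ|²
  -- cancels against the isotropic part of the moment of (ξ·z)².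
  rw [t1, t2, real_inner_self_eq_norm_sq]
  ring

/-! ### Convergence of the first variation -/

lemma measurableSet_timeSpace (T : ℝ) : MeasurableSet (timeSpace d T) :=
  measurableSet_Ioo.prod measurableSet_unitCube

lemma restrict_timeSpace (T : ℝ) : (volume : Measure (ℝ × Space d)).restrict (timeSpace d T)
    = (volume.restrict (Ioo 0 T)).prod (volume.restrict (unitCube d)) := by
  rw [Measure.prod_restrict]; rfl

instance (T : ℝ) : IsFiniteMeasure ((volume : Measure (ℝ × Space d)).restrict (timeSpace d T)) := by
  rw [restrict_timeSpace]; infer_instance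

/-- The density `G_1(z) h^{-1/2} u(t,x) (1 - u)(t, x - h^{1/2} z)`. -/
def correlationDensity (h : ℝ) (u : ℝ → Space d → ℝ) (z : Space d) (p : ℝ × Space d) : ℝ :=
  heatKernel d 1 z * (1 / Real.sqrt h * (u p.1 p.2 * (1 - u p.1 (p.2 - Real.sqrt h • z))))

lemma ae_fst_mem_timeSpace (T : ℝ) :
    ∀ᵐ q ∂(((volume : Measure (ℝ × Space d)).restrict (timeSpace d T)).prod
      (volume : Measure (Space d))), q.1 ∈ timeSpace d T :=
  Measure.quasiMeasurePreserving_fst.ae (ae_restrict_mem (measurableSet_timeSpace T))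

section

variable {T h : ℝ} {u : ℝ → Space d → ℝ}

lemma abs_mul_one_sub_le (u_mem : ∀ t ∈ Ioo (0 : ℝ) T, u t ∈ configSpace d) {p : ℝ × Space d}
    (hp : p ∈ timeSpace d T) (y : Space d) :
    0 ≤ u p.1 p.2 * (1 - u p.1 y) ∧ u p.1 p.2 * (1 - u p.1 y) ≤ 1 := by
  have h1 := (u_mem p.1 hp.1).2.2 p.2
  have h2 := (u_mem p.1 hp.1).2.2 y
  exact ⟨mul_nonneg h1.1 (by linarith [h2.2]),
    mul_le_one₀ h1.2 (by linarith [h2.2]) (by linarith [h2.1])⟩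

lemma correlationDensity_nonneg (u_mem : ∀ t ∈ Ioo (0 : ℝ) T, u t ∈ configSpace d)
    {p : ℝ × Space d} (hp : p ∈ timeSpace d T) (z : Space d) :
    0 ≤ correlationDensity h u z p := by
  have := (abs_mul_one_sub_le u_mem hp (p.2 - Real.sqrt h • z)).1
  have := heatKernel_nonneg (d := d) 1 z
  unfold correlationDensity
  positivity

lemma integrable_mul_correlationDensity
    (u_meas : Measurable (fun p : ℝ × Space d => u p.1 p.2))
    (u_mem : ∀ t ∈ Ioo (0 : ℝ) T, u t ∈ configSpace d) {f : Space d → ℝ × Space d → ℝ}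
    (hf : Continuous (fun q : Space d × (ℝ × Space d) => f q.1 q.2)) {C : ℝ} {m : ℕ}
    (hC : ∀ z p, |f z p| ≤ C * (1 + ‖z‖) ^ m) :
    Integrable (fun q : (ℝ × Space d) × Space d => f q.2 q.1 * correlationDensity h u q.2 q.1)
      ((volume.restrict (timeSpace d T)).prod volume) := by
  have h1 : Measurable fun q : (ℝ × Space d) × Space d => u q.1.1 q.1.2 :=
    u_meas.comp measurable_fst
  have h2 : Measurable fun q : (ℝ × Space d) × Space d => u q.1.1 (q.1.2 - Real.sqrt h • q.2) :=
    u_meas.comp ((measurable_fst.comp measurable_fst).prodMk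
      ((measurable_snd.comp measurable_fst).sub (measurable_snd.const_smul (Real.sqrt h))))
  have h3 : Measurable fun q : (ℝ × Space d) × Space d => f q.2 q.1 :=
    (hf.comp continuous_swap).measurable
  have h4 := integrable_prod_heatKernel_mul (ρ := (volume : Measure (ℝ × Space d)).restrict
    (timeSpace d T)) one_pos (f := fun q : (ℝ × Space d) × Space d => f q.2 q.1 *
      (1 / Real.sqrt h * (u q.1.1 q.1.2 * (1 - u q.1.1 (q.1.2 - Real.sqrt h • q.2)))))
    (Measurable.aestronglyMeasurable (by fun_prop)) (C * (1 / Real.sqrt h)) m (by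
      filter_upwards [ae_fst_mem_timeSpace T] with q hq
      obtain ⟨l, r⟩ := abs_mul_one_sub_le u_mem hq (q.1.2 - Real.sqrt h • q.2)
      rw [abs_mul, abs_of_nonneg (mul_nonneg (by positivity) l), mul_right_comm]
      exact mul_le_mul (hC _ _) (mul_le_of_le_one_right (by positivity) r)
        (mul_nonneg (by positivity) l) ((abs_nonneg _).trans (hC q.2 q.1)))
  refine h4.congr (ae_of_all _ fun q => ?_)
  simp only [correlationDensity]; ring

/-- The density is nonnegative on the domain, so the pointwise bound integrates. Because `e` is
itself a test function, weak convergence keeps the right-hand integral bounded even though the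
density carries h^{-1/2}. Fubini reconciles the two orders of integration. -/
lemma abs_integral_sub_le_integral_mul {f g e : Space d → ℝ × Space d → ℝ}
    (u_meas : Measurable (fun p : ℝ × Space d => u p.1 p.2))
    (u_mem : ∀ t ∈ Ioo (0 : ℝ) T, u t ∈ configSpace d)
    (hf : Continuous (fun q : Space d × (ℝ × Space d) => f q.1 q.2))
    (hg : IsTestFunction T g) (he : IsTestFunction T e) {c : ℝ}
    (hfg : ∀ z p, |f z p - g z p| ≤ c * e z p) :
    |(∫ t in Ioo 0 T, ∫ y in unitCube d, ∫ z, f z (t, y) * correlationDensity h u z (t, y))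
      - ∫ z, ∫ p in timeSpace d T, g z p * correlationDensity h u z p|
      ≤ c * ∫ z, ∫ p in timeSpace d T, e z p * correlationDensity h u z p := by
  obtain ⟨Cg, mg, hCg⟩ := hg.growth
  obtain ⟨Ce, me, hCe⟩ := he.growth
  have one : ∀ z : Space d, (1 : ℝ) ≤ 1 + ‖z‖ := fun z => by simp
  have hCf : ∀ z p, |f z p| ≤ (|Cg| + |c| * |Ce|) * (1 + ‖z‖) ^ (mg + me) := by
    intro z p
    have h1 : |f z p| ≤ |g z p| + |f z p - g z p| := by
      calc |f z p| = |g z p + (f z p - g z p)| := by rw [add_sub_cancel]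
        _ ≤ _ := abs_add_le _ _
    have h2 : |g z p| ≤ |Cg| * (1 + ‖z‖) ^ (mg + me) :=
      (hCg z p).trans (by
        gcongr
        exacts [le_abs_self _, one z, Nat.le_add_right _ _])
    have h3 : |e z p| ≤ |Ce| * (1 + ‖z‖) ^ (mg + me) :=
      (hCe z p).trans (by
        gcongr
        exacts [le_abs_self _, one z, Nat.le_add_left _ _])
    have h4 : |f z p - g z p| ≤ |c| * (|Ce| * (1 + ‖z‖) ^ (mg + me)) :=
      ((hfg z p).trans (le_abs_self _)).trans (by rw [abs_mul]; gcongr)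
    linarith
  have If := integrable_mul_correlationDensity (h := h) u_meas u_mem hf hCf
  have Ig := integrable_mul_correlationDensity (h := h) u_meas u_mem hg.continuous hCg
  have Ie := integrable_mul_correlationDensity (h := h) u_meas u_mem he.continuous hCe
  have e1 : ∫ t in Ioo 0 T, ∫ y in unitCube d, ∫ z, f z (t, y) * correlationDensity h u z (t, y)
      = ∫ q, f q.2 q.1 * correlationDensity h u q.2 q.1
        ∂((volume.restrict (timeSpace d T)).prod volume) := by
    rw [integral_prod _ If]
    have := If.integral_prod_left
    rw [restrict_timeSpace] at this ⊢
    rw [integral_prod _ this]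
  rw [e1, ← integral_prod_symm _ Ig, ← integral_prod_symm _ Ie, ← integral_sub If Ig,
    ← integral_const_mul, ← Real.norm_eq_abs]
  refine norm_integral_le_of_norm_le (Ie.const_mul c) ?_
  filter_upwards [ae_fst_mem_timeSpace T] with q hq
  have h0 := correlationDensity_nonneg (h := h) u_mem hq q.2
  rw [← sub_mul, Real.norm_eq_abs, abs_mul, abs_of_nonneg h0, ← mul_assoc]
  exact mul_le_mul_of_nonneg_right (hfg _ _) h0

end

/-- A continuous cutoff in time. -/
lemma exists_time_cutoff {a b T : ℝ} (ha : 0 < a) (hb : b < T) : ∃ η : ℝ → ℝ, Continuous η ∧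
    (∀ t, 0 ≤ η t) ∧ (∀ t, η t ≤ 1) ∧ (∀ t ∈ Icc a b, η t = 1) ∧
    ∃ a' b' : ℝ, 0 < a' ∧ b' < T ∧ ∀ t, t ∉ Icc a' b' → η t = 0 := by
  refine ⟨fun t => max 0 (min 1 (min ((t - a / 2) / (a / 2)) (((b + T) / 2 - t) / ((T - b) / 2)))),
    by fun_prop, fun t => le_max_left _ _, fun t => max_le zero_le_one (min_le_left _ _), ?_,
    a / 2, (b + T) / 2, by linarith, by linarith, ?_⟩
  · intro t ht
    have h1 : 1 ≤ (t - a / 2) / (a / 2) := by rw [le_div_iff₀ (by linarith)]; linarith [ht.1]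
    have h2 : 1 ≤ ((b + T) / 2 - t) / ((T - b) / 2) := by
      rw [le_div_iff₀ (by linarith)]; linarith [ht.2]
    simp only [min_eq_left (le_min h1 h2), max_eq_right zero_le_one]
  · intro t ht
    refine max_eq_left ((min_le_right _ _).trans ?_)
    rw [mem_Icc, not_and_or, not_le, not_le] at ht
    rcases ht with ht | ht
    · exact (min_le_left _ _).trans (div_nonpos_of_nonpos_of_nonneg (by linarith) (by linarith))
    · exact (min_le_right _ _).trans (div_nonpos_of_nonpos_of_nonneg (by linarith) (by linarith))

lemma continuous_correlationTest {T : ℝ} {ξ : ℝ → Space d → Space d} (H : IsTestField T ξ)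
    (h : ℝ) : Continuous fun q : Space d × (ℝ × Space d) =>
      correlationTest h (ξ q.2.1) q.1 q.2.2 := by
  have c1 := H.smooth.continuous
  have c2 := continuous_coordTrace.comp H.contDiff_fderiv.continuous
  have g1 : Continuous fun q : Space d × (ℝ × Space d) => q.2 := continuous_snd
  have g2 : Continuous fun q : Space d × (ℝ × Space d) => (q.2.1, q.2.2 - Real.sqrt h • q.1) := by
    fun_prop
  have a1 : Continuous fun q : Space d × (ℝ × Space d) => ξ q.2.1 q.2.2 := c1.comp g1
  have a2 : Continuous fun q : Space d × (ℝ × Space d) => ξ q.2.1 (q.2.2 - Real.sqrt h • q.1) :=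
    c1.comp g2
  have b1 : Continuous fun q : Space d × (ℝ × Space d) =>
    coordTrace (fderiv ℝ (ξ q.2.1) q.2.2) := c2.comp g1
  have b2 : Continuous fun q : Space d × (ℝ × Space d) =>
    coordTrace (fderiv ℝ (ξ q.2.1) (q.2.2 - Real.sqrt h • q.1)) := c2.comp g2
  unfold correlationTest
  fun_prop

lemma IsTestField.isTestFunction_limitTest {T : ℝ} {ξ : ℝ → Space d → Space d}
    (H : IsTestField T ξ) : IsTestFunction T (fun z p => limitTest (ξ p.1) z p.2) := by
  have c1 := H.smooth.continuous
  have c2 := H.contDiff_fderiv.continuous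
  obtain ⟨M, -, hM⟩ := H.exists_bound
  refine ⟨?_, fun z t i x => ?_, ?_, _, _, fun z p => abs_limitTest_le (hM p.1).1 z p.2⟩
  · have a1 : Continuous fun q : Space d × (ℝ × Space d) => ξ q.2.1 q.2.2 :=
      c1.comp continuous_snd
    have a2 : Continuous fun q : Space d × (ℝ × Space d) => fderiv ℝ (ξ q.2.1) q.2.2 :=
      c2.comp continuous_snd
    have a3 := continuous_coordTrace.comp a2
    have a4 : Continuous fun q : Space d × (ℝ × Space d) => fderiv ℝ (ξ q.2.1) q.2.2 q.1 :=
      a2.clm_apply continuous_fst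
    simp only [Function.comp_def] at a3
    unfold limitTest
    fun_prop
  · simp only [limitTest, H.periodic t i x, (H.periodic t).fderiv i x]
  · obtain ⟨a, b, ha, hb, hab⟩ := H.support
    refine ⟨a, b, ha, hb, fun z t x ht => ?_⟩
    have h0 : ξ t = fun _ => 0 := funext (hab t ht)
    have h1 : fderiv ℝ (ξ t) x = 0 := by rw [h0]; exact fderiv_const_apply 0
    simp [limitTest, h0, coordTrace]

/-- The first variations converge to the first variation of the perimeter minus the squared
normal speed. -/
lemma tendsto_integral_correlationTest {T : ℝ} {h : ℕ → ℝ} (h_pos : ∀ k, 0 < h k)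
    (h_lim : Tendsto h atTop (𝓝 0)) {u : ℕ → ℝ → Space d → ℝ}
    (u_meas : ∀ k, Measurable (fun p : ℝ × Space d => u k p.1 p.2))
    (u_mem : ∀ k, ∀ t ∈ Ioo (0 : ℝ) T, u k t ∈ configSpace d)
    {μ : Measure (ℝ × Space d)} [IsFiniteMeasure μ] {ν : ℝ × Space d → Space d}
    (hν : Measurable ν) (hν1 : ∀ᵐ p ∂μ, ‖ν p‖ = 1)
    (conv : CorrelationConverges T h u (fun k t x => 1 - u k t x) (fun s => max s 0) μ ν)
    {ξ : ℝ → Space d → Space d} (H : IsTestField T ξ) :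
    Tendsto (fun k => ∫ t in Ioo 0 T, ∫ y in unitCube d, ∫ z,
        correlationTest (h k) (ξ t) z y * correlationDensity (h k) (u k) z (t, y)) atTop
      (𝓝 (c₀ * ∫ p, (-(spaceDiv ξ p - normalDeriv ξ (ν p) p)
        - inner ℝ (ν p) (ξ p.1 p.2) ^ 2) ∂μ)) := by
  obtain ⟨M, hM0, hM⟩ := H.exists_bound
  obtain ⟨a, b, ha, hb, hab⟩ := H.support
  obtain ⟨η, ηc, η0, η1, ηab, a', b', ha', hb', ηs⟩ := exists_time_cutoff ha hb
  have hg := H.isTestFunction_limitTest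
  -- The error majorant (1 + |z|)³ is not compactly supported in time; the cutoff makes it
  -- admissible and equals 1 on the time support of ξ.
  have he : IsTestFunction T (fun (z : Space d) (p : ℝ × Space d) => η p.1 * (1 + ‖z‖) ^ 3) := by
    refine ⟨by fun_prop, fun z t i x => rfl, ⟨a', b', ha', hb', fun z t x ht => ?_⟩, 1, 3,
      fun z p => ?_⟩
    · simp [ηs t ht]
    · rw [abs_of_nonneg (mul_nonneg (η0 _) (by positivity))]
      exact mul_le_mul_of_nonneg_right (η1 _) (by positivity)
  set K := d * M + M + (d * M * (d * M + M) + M * (d * M) + M * M) + M * M with hK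
  have hlim := conv _ hg
  have elim := conv _ he
  have eval : ∫ z, ∫ p, limitTest (ξ p.1) z p.2 *
      (heatKernel d 1 z * max (inner ℝ (ν p) z) 0) ∂μ
      = c₀ * ∫ p, (-(spaceDiv ξ p - normalDeriv ξ (ν p) p)
        - inner ℝ (ν p) (ξ p.1 p.2) ^ 2) ∂μ := by
    have hI : Integrable (fun q : (ℝ × Space d) × Space d => heatKernel d 1 q.2 *
        (limitTest (ξ q.1.1) q.2 q.1.2 * max (inner ℝ (ν q.1) q.2) 0)) (μ.prod volume) := by
      obtain ⟨C, m, hC⟩ := hg.growth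
      have m1 : Measurable fun q : (ℝ × Space d) × Space d => limitTest (ξ q.1.1) q.2 q.1.2 :=
        (hg.continuous.comp continuous_swap).measurable
      refine integrable_prod_heatKernel_mul one_pos
        (Measurable.aestronglyMeasurable (by fun_prop)) C (m + 1) ?_
      filter_upwards [Measure.quasiMeasurePreserving_fst.ae hν1] with q hq
      rw [abs_mul, pow_succ, ← mul_assoc, abs_of_nonneg (le_max_right _ (0 : ℝ))]
      refine mul_le_mul (hC q.2 q.1) (max_le ((le_abs_self _).trans
        ((abs_inner_le_one_add _ _).trans (by rw [hq, one_mul]))) (by positivity))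
        (le_max_right _ _) ((abs_nonneg _).trans (hC q.2 q.1))
    have h1 := integral_prod_symm _ hI
    rw [integral_prod _ hI] at h1
    have h2 : ∀ (z : Space d) (p : ℝ × Space d), limitTest (ξ p.1) z p.2 *
      (heatKernel d 1 z * max (inner ℝ (ν p) z) 0) = heatKernel d 1 z *
        (limitTest (ξ p.1) z p.2 * max (inner ℝ (ν p) z) 0) := fun z p => by ring
    simp_rw [h2]
    rw [← h1, ← integral_const_mul]
    refine integral_congr_ae ?_
    filter_upwards [hν1] with p hp
    simp_rw [← h2]
    exact integral_limitTest (ξ p.1) hp p.2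
  have h2 : Tendsto (fun k => K * Real.sqrt (h k) * ∫ z, ∫ p in timeSpace d T,
      (η p.1 * (1 + ‖z‖) ^ 3) * correlationDensity (h k) (u k) z p) atTop (𝓝 0) := by
    have h3 : Tendsto (fun k => K * Real.sqrt (h k)) atTop (𝓝 0) := by
      simpa using ((Real.continuous_sqrt.tendsto 0).comp h_lim).const_mul K
    have h5 := h3.mul elim
    rw [zero_mul] at h5
    exact h5
  have h4 : ∀ᶠ k in atTop, |(∫ t in Ioo 0 T, ∫ y in unitCube d, ∫ z,
        correlationTest (h k) (ξ t) z y * correlationDensity (h k) (u k) z (t, y))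
      - ∫ z, ∫ p in timeSpace d T, limitTest (ξ p.1) z p.2 * correlationDensity (h k) (u k) z p|
      ≤ K * Real.sqrt (h k) * ∫ z, ∫ p in timeSpace d T,
      (η p.1 * (1 + ‖z‖) ^ 3) * correlationDensity (h k) (u k) z p := by
    filter_upwards [h_lim.eventually (gt_mem_nhds one_pos)] with k hk
    refine abs_integral_sub_le_integral_mul (f := fun z p => correlationTest (h k) (ξ p.1) z p.2)
      (u_meas k) (u_mem k) (continuous_correlationTest H (h k)) hg he fun z p => ?_
    by_cases hp : p.1 ∈ Icc a b
    · rw [ηab _ hp, one_mul]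
      exact abs_correlationTest_sub_limitTest_le (hM p.1).1 (hM p.1).2 (h_pos k) hk.le z p.2
    · have h0 : ξ p.1 = fun _ => 0 := funext (hab p.1 hp)
      have h1 : correlationTest (h k) (ξ p.1) z p.2 - limitTest (ξ p.1) z p.2 = 0 := by
        simp [correlationTest, limitTest, h0, coordTrace]
      rw [h1, abs_zero]
      have := η0 p.1
      positivity
  have h5 := squeeze_zero_norm' (h4.mono fun k hk => (Real.norm_eq_abs _).trans_le hk) h2
  beta_reduce at hlim
  rw [eval] at hlim
  have h6 := h5.add hlim
  rw [zero_add] at h6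
  exact h6.congr fun k => sub_add_cancel _ _

/-- The liminf of the slopes bounds the first variation along every test field. -/
lemma ofReal_first_variation_le_liminf {T : ℝ} {h : ℕ → ℝ} (h_pos : ∀ k, 0 < h k)
    (h_lim : Tendsto h atTop (𝓝 0)) {u : ℕ → ℝ → Space d → ℝ}
    (u_meas : ∀ k, Measurable (fun p : ℝ × Space d => u k p.1 p.2))
    (u_mem : ∀ k, ∀ t ∈ Ioo (0 : ℝ) T, u k t ∈ configSpace d)
    {μ : Measure (ℝ × Space d)} [IsFiniteMeasure μ] {ν : ℝ × Space d → Space d}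
    (hν : Measurable ν) (hν1 : ∀ᵐ p ∂μ, ‖ν p‖ = 1)
    (conv : CorrelationConverges T h u (fun k t x => 1 - u k t x) (fun s => max s 0) μ ν)
    {ξ : ℝ → Space d → Space d} (H : IsTestField T ξ) :
    ENNReal.ofReal (c₀ * ∫ p, (-(spaceDiv ξ p - normalDeriv ξ (ν p) p)
        - inner ℝ (ν p) (ξ p.1 p.2) ^ 2) ∂μ)
      ≤ liminf (fun k => ∫⁻ t in Ioo (0 : ℝ) T,
          (1 / 2) * energySlope (h k) (u k t) ^ 2) atTop := by
  obtain ⟨M, -, hM⟩ := H.exists_bound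
  have h1 := (ENNReal.continuous_ofReal.tendsto _).comp
    (tendsto_integral_correlationTest h_pos h_lim u_meas u_mem hν hν1 conv H)
  rw [← h1.liminf_eq]
  refine liminf_le_liminf (Eventually.of_forall fun k => ?_)
  -- Stated for arbitrary φ, a non-integrable one having integral 0, so that no regularity in time
  -- has to be checked.
  have h2 : ∀ φ : ℝ → ℝ, ENNReal.ofReal (∫ t in Ioo 0 T, φ t)
      ≤ ∫⁻ t in Ioo 0 T, ENNReal.ofReal (φ t) := by
    intro φ
    by_cases hφ : Integrable φ (volume.restrict (Ioo 0 T))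
    · rw [integral_eq_lintegral_pos_part_sub_lintegral_neg_part hφ]
      refine (ENNReal.ofReal_le_ofReal (sub_le_self _ ENNReal.toReal_nonneg)).trans ?_
      exact ENNReal.ofReal_toReal_le
    · simp [integral_undef hφ]
  refine (h2 _).trans (setLIntegral_mono' measurableSet_Ioo fun t ht => ?_)
  have h3 := (hM t).1.le_energySlope (h_pos k) (u_mem k t ht)
  rwa [(hM t).1.variation_eq_correlation (h_pos k) (u_mem k t ht)] at h3

/-! ### Riesz representation of the curvature -/

/-- The bound forces `A` to vanish on the kernel of `ι`, hence to factor through its range. The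
range need not be closed, so the functional is first extended by Hahn–Banach with the same norm and
then represented by Riesz. -/
lemma exists_riesz_of_abs_le {V E : Type*} [AddCommGroup V] [Module ℝ V] [NormedAddCommGroup E]
    [InnerProductSpace ℝ E] [CompleteSpace E] (ι : V →ₗ[ℝ] E) (A : V →ₗ[ℝ] ℝ) {C : ℝ}
    (hC : 0 ≤ C) (hA : ∀ v, |A v| ≤ C * ‖ι v‖) :
    ∃ w : E, ‖w‖ ≤ C ∧ ∀ v, A v = inner ℝ w (ι v) := by
  have hker : LinearMap.ker ι ≤ LinearMap.ker A := by
    intro v hv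
    have h1 := hA v
    rw [LinearMap.mem_ker.1 hv, norm_zero, mul_zero] at h1
    exact LinearMap.mem_ker.2 (abs_nonpos_iff.1 h1)
  set f : LinearMap.range ι →ₗ[ℝ] ℝ :=
    ((LinearMap.ker ι).liftQ A hker).comp ι.quotKerEquivRange.symm.toLinearMap
  have hf : ∀ v, f ⟨ι v, LinearMap.mem_range_self ι v⟩ = A v := by
    intro v
    have h1 : ι.quotKerEquivRange.symm ⟨ι v, LinearMap.mem_range_self ι v⟩
        = (LinearMap.ker ι).mkQ v := by
      rw [LinearEquiv.symm_apply_eq]; rfl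
    simp [f, h1]
  have hfb : ∀ x, ‖f x‖ ≤ C * ‖x‖ := by
    rintro ⟨-, v, rfl⟩
    rw [hf v]
    exact hA v
  obtain ⟨g, hg, hgn⟩ := exists_extension_norm_eq (LinearMap.range ι) (f.mkContinuous C hfb)
  refine ⟨(InnerProductSpace.toDual ℝ E).symm g, ?_, fun v => ?_⟩
  · rw [LinearIsometryEquiv.norm_map, hgn]
    exact f.mkContinuous_norm_le hC hfb
  · rw [InnerProductSpace.toDual_symm_apply, ← hf v]
    exact (hg ⟨ι v, LinearMap.mem_range_self ι v⟩).symm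

/-- The vector space of test fields. -/
def testFields (d : ℕ) (T : ℝ) : Submodule ℝ (ℝ → Space d → Space d) where
  carrier := {ξ | IsTestField T ξ}
  zero_mem' := by
    refine ⟨contDiff_const, fun t i x => rfl, ?_⟩
    rcases le_or_gt T 0 with hT | hT
    · exact ⟨1, T - 1, one_pos, by linarith, fun t _ x => rfl⟩
    · exact ⟨T / 2, T / 2, by linarith, by linarith, fun t _ x => rfl⟩
  add_mem' := by
    rintro ξ ζ ⟨h1, h2, a, b, ha, hb, h3⟩ ⟨k1, k2, a', b', ha', hb', k3⟩
    refine ⟨h1.add k1, fun t i x => ?_, min a a', max b b', lt_min ha ha', max_lt hb hb',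
      fun t ht x => ?_⟩
    · simp only [Pi.add_apply, h2 t i x, k2 t i x]
    · rw [mem_Icc, not_and_or, not_le, not_le, lt_min_iff, max_lt_iff] at ht
      have e1 : t ∉ Icc a b := by
        rw [mem_Icc, not_and_or, not_le, not_le]; exact ht.imp And.left And.left
      have e2 : t ∉ Icc a' b' := by
        rw [mem_Icc, not_and_or, not_le, not_le]; exact ht.imp And.right And.right
      simp only [Pi.add_apply, h3 t e1 x, k3 t e2 x, add_zero]
  smul_mem' := by
    rintro c ξ ⟨h1, h2, a, b, ha, hb, h3⟩
    refine ⟨h1.const_smul c, fun t i x => ?_, a, b, ha, hb, fun t ht x => ?_⟩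
    · simp only [Pi.smul_apply, h2 t i x]
    · simp only [Pi.smul_apply, h3 t ht x, smul_zero]

section

variable {T : ℝ} {μ : Measure (ℝ × Space d)} [IsFiniteMeasure μ]
  {ν : ℝ × Space d → Space d}

lemma IsTestField.memLp_inner {ξ : ℝ → Space d → Space d} (H : IsTestField T ξ)
    (hν : Measurable ν) (hν1 : ∀ᵐ p ∂μ, ‖ν p‖ = 1) :
    MemLp (fun p => inner ℝ (ν p) (ξ p.1 p.2)) 2 μ := by
  obtain ⟨M, -, hM⟩ := H.exists_bound
  have h1 : Measurable fun p : ℝ × Space d => ξ p.1 p.2 := H.smooth.continuous.measurable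
  refine MemLp.of_bound (Measurable.aestronglyMeasurable (by fun_prop)) M ?_
  filter_upwards [hν1] with p hp
  refine (norm_inner_le_norm _ _).trans ?_
  rw [hp, one_mul]
  exact (hM p.1).1.bound p.2

lemma IsTestField.integrable_variation {ξ : ℝ → Space d → Space d} (H : IsTestField T ξ)
    (hν : Measurable ν) (hν1 : ∀ᵐ p ∂μ, ‖ν p‖ = 1) :
    Integrable (fun p => spaceDiv ξ p - normalDeriv ξ (ν p) p) μ := by
  obtain ⟨M, hM0, hM⟩ := H.exists_bound
  have c := H.contDiff_fderiv.continuous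
  have m1 : AEStronglyMeasurable (fun p => spaceDiv ξ p) μ :=
    (continuous_coordTrace.comp c).aestronglyMeasurable
  have m2 : AEStronglyMeasurable (fun p => normalDeriv ξ (ν p) p) μ := by
    have h1 : AEStronglyMeasurable (fun p => (fderiv ℝ (ξ p.1) p.2) (ν p)) μ :=
      (isBoundedBilinearMap_apply (𝕜 := ℝ) (E := Space d) (F := Space d)).continuous.comp_aestronglyMeasurable
        (c.aestronglyMeasurable.prodMk hν.aestronglyMeasurable)
    exact hν.aestronglyMeasurable.inner h1
  refine (integrable_const (d * M + M)).mono' (m1.sub m2) ?_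
  filter_upwards [hν1] with p hp
  refine (norm_sub_le _ _).trans (add_le_add ?_ ?_)
  · exact (abs_coordTrace_le _).trans (by gcongr; exact (hM p.1).1.bound_fderiv p.2)
  · refine (norm_inner_le_norm _ _).trans ?_
    have h2 := (fderiv ℝ (ξ p.1) p.2).le_opNorm (ν p)
    rw [hp, mul_one] at h2
    rw [hp, one_mul]
    exact h2.trans ((hM p.1).1.bound_fderiv p.2)

/-- The normal component of a test field as an element of `L²(μ)`. -/
def normalComponent (hν : Measurable ν) (hν1 : ∀ᵐ p ∂μ, ‖ν p‖ = 1) :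
    testFields d T →ₗ[ℝ] Lp ℝ 2 μ where
  toFun ξ := (IsTestField.memLp_inner ξ.2 hν hν1).toLp _
  map_add' ξ ζ := by
    rw [← MemLp.toLp_add]
    congr 1; ext p
    simp [inner_add_right]
  map_smul' c ξ := by
    rw [RingHom.id_apply, ← MemLp.toLp_const_smul]
    congr 1; ext p
    simp [inner_smul_right]

lemma IsTestField.differentiable {ξ : ℝ → Space d → Space d} (H : IsTestField T ξ) (t : ℝ) :
    Differentiable ℝ (ξ t) := (H.contDiff_section t).differentiable (by simp)

/-- The first variation of the perimeter as a linear functional on test fields. -/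
def firstVariation (hν : Measurable ν) (hν1 : ∀ᵐ p ∂μ, ‖ν p‖ = 1) : testFields d T →ₗ[ℝ] ℝ where
  toFun ξ := ∫ p, -(spaceDiv ξ p - normalDeriv ξ (ν p) p) ∂μ
  map_add' ξ ζ := by
    have i1 : Integrable (fun p => -(spaceDiv ξ.1 p - normalDeriv ξ.1 (ν p) p)) μ :=
      (IsTestField.integrable_variation ξ.2 hν hν1).neg
    have i2 : Integrable (fun p => -(spaceDiv ζ.1 p - normalDeriv ζ.1 (ν p) p)) μ :=
      (IsTestField.integrable_variation ζ.2 hν hν1).neg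
    rw [← integral_add i1 i2]
    congr 1; ext p
    have h1 : fderiv ℝ ((ξ + ζ : testFields d T).1 p.1) p.2
        = fderiv ℝ (ξ.1 p.1) p.2 + fderiv ℝ (ζ.1 p.1) p.2 :=
      fderiv_add (IsTestField.differentiable ξ.2 p.1 p.2)
        (IsTestField.differentiable ζ.2 p.1 p.2)
    simp only [spaceDiv, normalDeriv, h1, add_apply, PiLp.add_apply,
      Finset.sum_add_distrib, inner_add_right]
    ring
  map_smul' c ξ := by
    rw [RingHom.id_apply, smul_eq_mul, ← integral_const_mul]
    congr 1; ext p
    have h1 : fderiv ℝ ((c • ξ : testFields d T).1 p.1) p.2 = c • fderiv ℝ (ξ.1 p.1) p.2 :=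
      fderiv_const_smul (IsTestField.differentiable ξ.2 p.1 p.2) c
    simp only [spaceDiv, normalDeriv, h1, smul_apply, PiLp.smul_apply,
      smul_eq_mul, ← Finset.mul_sum, inner_smul_right]
    ring

lemma norm_normalComponent_sq (hν : Measurable ν) (hν1 : ∀ᵐ p ∂μ, ‖ν p‖ = 1)
    (ξ : testFields d T) :
    ‖normalComponent hν hν1 ξ‖ ^ 2 = ∫ p, inner ℝ (ν p) (ξ.1 p.1 p.2) ^ 2 ∂μ := by
  rw [← real_inner_self_eq_norm_sq, L2.inner_def]
  refine integral_congr_ae ?_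
  filter_upwards [(IsTestField.memLp_inner ξ.2 hν hν1).coeFn_toLp] with p hp
  change inner ℝ (((IsTestField.memLp_inner ξ.2 hν hν1).toLp _) p) _ = _
  rw [show (normalComponent hν hν1 ξ : ℝ × Space d → ℝ) p
    = ((IsTestField.memLp_inner ξ.2 hν hν1).toLp _ : ℝ × Space d → ℝ) p from rfl, hp]
  simp [sq]

end

end Thresholding

end

/-! ### Optimisation over the test field and conclusion -/

theorem proposition3 (d : ℕ) (T : ℝ) (hT : 0 < T)
    -- a sequence `h ↓ 0`
    (h : ℕ → ℝ) (h_pos : ∀ k, 0 < h k) (h_lim : Tendsto h atTop (𝓝 0))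
    -- the `[0,1]`-valued functions `u_h` on `(0,T) × torus`
    (u : ℕ → ℝ → Thresholding.Space d → ℝ)
    (u_meas : ∀ k, Measurable (fun p : ℝ × Thresholding.Space d => u k p.1 p.2))
    (u_mem : ∀ k, ∀ t ∈ Ioo (0 : ℝ) T, u k t ∈ Thresholding.configSpace d)
    -- the `{0,1}`-valued function `χ` on `(0,T) × torus`
    (χ : ℝ → Thresholding.Space d → ℝ)
    (χ_meas : Measurable (fun p : ℝ × Thresholding.Space d => χ p.1 p.2))
    (χ_per : ∀ t ∈ Ioo (0 : ℝ) T, Thresholding.TorusPeriodic (χ t))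
    (χ_val : ∀ t ∈ Ioo (0 : ℝ) T, ∀ x, χ t x = 0 ∨ χ t x = 1)
    -- its gradient is a bounded measure, `μ = |∇χ|dt` and `ν` is the normal
    (μ : Measure (ℝ × Thresholding.Space d))
    (ν : ℝ × Thresholding.Space d → Thresholding.Space d)
    (polar : Thresholding.IsGradientPolar T χ μ ν)
    -- the two weak convergences
    (conv_pos : Thresholding.CorrelationConverges T h
      u (fun k t x => 1 - u k t x) (fun s => max s 0) μ ν)
    (conv_neg : Thresholding.CorrelationConverges T h
      (fun k t x => 1 - u k t x) u (fun s => max (-s) 0) μ ν)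
    -- the limit inferior below is finite
    (slope_fin : liminf (fun k => ∫⁻ t in Ioo (0 : ℝ) T,
      (1 / 2) * Thresholding.energySlope (h k) (u k t) ^ 2) atTop ≠ ⊤) :
    ∃ H : ℝ × Thresholding.Space d → ℝ,
      MemLp H 2 μ ∧
      Thresholding.IsMeanCurvature T μ ν H ∧
      ENNReal.ofReal (Thresholding.c₀ * ∫ p, (H p / 2) ^ 2 ∂μ) ≤
        liminf (fun k => ∫⁻ t in Ioo (0 : ℝ) T,
          (1 / 2) * Thresholding.energySlope (h k) (u k t) ^ 2) atTop := by
  open Thresholding in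
  have hμ : IsFiniteMeasure μ := polar.bounded
  have hν := polar.measurable_normal
  have hν1 := polar.norm_normal
  have key := fun ξ (hξ : IsTestField T ξ) => ofReal_first_variation_le_liminf h_pos h_lim u_meas
    u_mem hν hν1 conv_pos hξ
  set L := liminf (fun k => ∫⁻ t in Ioo (0 : ℝ) T,
      (1 / 2) * energySlope (h k) (u k t) ^ 2) atTop
  have hc : 0 < c₀ := by unfold c₀; positivity
  set K := L.toReal / c₀
  have hK : 0 ≤ K := div_nonneg ENNReal.toReal_nonneg hc.le
  set ι := normalComponent (T := T) hν hν1
  set A := firstVariation (T := T) hν hν1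
  have h1 : ∀ ξ, A ξ ≤ K + ‖ι ξ‖ ^ 2 := by
    intro ξ
    have h2 := (ENNReal.ofReal_le_iff_le_toReal slope_fin).1 (key ξ.1 ξ.2)
    have i1 : Integrable (fun p => -(spaceDiv ξ.1 p - normalDeriv ξ.1 (ν p) p)) μ :=
      (IsTestField.integrable_variation ξ.2 hν hν1).neg
    rw [integral_sub i1 (IsTestField.memLp_inner ξ.2 hν hν1).integrable_sq,
      ← norm_normalComponent_sq hν hν1 ξ] at h2
    have h3 : A ξ - ‖ι ξ‖ ^ 2 ≤ K := by
      rw [le_div_iff₀ hc, mul_comm]; exact h2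
    linarith
  have h2 : ∀ ξ, |A ξ| ≤ Real.sqrt (4 * K) * ‖ι ξ‖ := by
    intro ξ
    -- The inequality at x • ξ says that ‖ι ξ‖² x² − (A ξ) x + K ≥ 0 for all real x; its
    -- discriminant condition is the optimal choice of amplitude.
    have h3 : discrim (‖ι ξ‖ ^ 2) (-A ξ) K ≤ 0 := by
      refine discrim_le_zero fun x => ?_
      have h4 := h1 (x • ξ)
      rw [map_smul, map_smul, norm_smul, mul_pow, Real.norm_eq_abs, sq_abs, smul_eq_mul] at h4
      linarith
    rw [discrim] at h3
    refine abs_le_of_sq_le_sq ?_ (by positivity)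
    rw [mul_pow, Real.sq_sqrt (by positivity)]
    linarith
  -- The representative `w` is the curvature H, and its norm bound √(4K), with K = L / c₀, is
  -- exactly what the final inequality needs.
  obtain ⟨w, hw, hA⟩ := exists_riesz_of_abs_le ι A (Real.sqrt_nonneg _) h2
  refine ⟨w, Lp.memLp w, fun ξ hξ => ?_, ?_⟩
  · have h3 := hA ⟨ξ, hξ⟩
    have h4 : A ⟨ξ, hξ⟩ = -∫ p, (spaceDiv ξ p - normalDeriv ξ (ν p) p) ∂μ := integral_neg _
    rw [h4, L2.inner_def] at h3
    rw [← neg_eq_iff_eq_neg, h3]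
    refine integral_congr_ae ?_
    filter_upwards [(hξ.memLp_inner hν hν1).coeFn_toLp] with p hp
    change inner ℝ (w p) (((hξ.memLp_inner hν hν1).toLp _ : _ → ℝ) p) = _
    rw [hp]
    simp [mul_comm]
  · have h3 : ∫ p, (w p / 2) ^ 2 ∂μ = ‖w‖ ^ 2 / 4 := by
      rw [← real_inner_self_eq_norm_sq, L2.inner_def, ← integral_div]
      congr 1; ext p
      simp; ring
    rw [h3, ENNReal.ofReal_le_iff_le_toReal slope_fin]
    have h4 : ‖w‖ ^ 2 ≤ 4 * K := by
      rw [← Real.sq_sqrt (by positivity : 0 ≤ 4 * K)]; gcongr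
    calc _ ≤ c₀ * (4 * K / 4) := by gcongr
      _ = L.toReal := by simp only [K]; field_simp
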